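/- Let $\Bbbk$ be an algebraically closed field of characteristic zero and let $\mathfrak g$ be a finite-dimensional semisimple Lie algebra over $\Bbbk$, of rank $\operatorname{rk}(\mathfrak g)$. For a finite-dimensional Lie algebra $\mathfrak a$ over $\Bbbk$ and $f\in\mathfrak a^*$, let $\mathfrak a^{(f)}=\{X\in\mathfrak a : f([X,Y])=0 \text{ for all } Y\in\mathfrak a\}$; the index of $\mathfrak a$ is $\chi(\mathfrak a)=\min_{f\in\mathfrak a^*}\dim\mathfrak a^{(f)}$. For a Cartan subalgebra $\mathfrak h$ of $\mathfrak g$, let $R$ be the root system of $(\mathfrak g,\mathfrak h)$, with root spaces $\mathfrak g^\alpha$. A Borel subalgebra of $\mathfrak g$ is a subalgebra of the form $\mathfrak h\oplus\bigoplus_{\alpha\in R_+}\mathfrak g^\alpha$, for some Cartan subalgebra $\mathfrak h$ and the set $R_+$ of positive roots relative to some base of $R$. A parabolic subalgebra is a subalgebra containing a Borel subalgebra. Two parabolic subalgebras $\mathfrak p,\mathfrak p'$ are weakly opposite if $\mathfrak p+\mathfrak p'=\mathfrak g$. A special (seaweed) subalgebra of $\mathfrak g$ is a subalgebra of the form $\mathfrak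 q=\mathfrak p\cap\mathfrak p'$ with $\mathfrak p,\mathfrak p'$ weakly opposite parabolic subalgebras. A Levi subalgebra of $\mathfrak g$ (a Levi factor of a parabolic subalgebra) is a subalgebra of the form $\mathfrak h\oplus\bigoplus_{\alpha\in R\cap\mathbb Z S}\mathfrak g^\alpha$, for some Cartan subalgebra $\mathfrak h$, some base $\Pi$ of $R$ and some subset $S\subseteq\Pi$. Let $\mathfrak q$ be a special subalgebra of $\mathfrak g$. Then: (i) $\chi(\mathfrak q)\le\operatorname{rk}(\mathfrak g)$; (ii) $\chi(\mathfrak q)=\operatorname{rk}(\mathfrak g)$ if and only if $\mathfrak q$ is a Levi subalgebra of $\mathfrak g$. -/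

import Mathlib

namespace SpecialSubalgebra

open LieAlgebra LieAlgebra.IsKilling Module

section Index

variable (K L : Type*) [Field K] [LieRing L] [LieAlgebra K L]

/-- The alternating bilinear form `Φ_f (x, y) = f ⁅x, y⁆` attached to a linear form `f`. -/
def coadjointForm (f : Dual K L) : LinearMap.BilinForm K L :=
  LinearMap.mk₂ K (fun x y => f ⁅x, y⁆)
    (fun x x' y => by simp) (fun c x y => by simp)
    (fun x y y' => by simp) (fun c x y => by simp)

/-- The index of a (finite-dimensional) Lie algebra: the least dimension of the kernel of `Φ_f`,
for `f` in the dual. -/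
noncomputable def index : ℕ :=
  ⨅ f : Dual K L, finrank K (LinearMap.ker (coadjointForm K L f))

end Index

section RootSubspaces

variable {K L : Type*} [Field K] [LieRing L] [LieAlgebra K L] [FiniteDimensional K L]

/-- For a Cartan subalgebra `H` and a set `P` of roots, the subspace
`H ⊕ ⨁ α ∈ P, L^α` of `L`. -/
def cartanSum (H : LieSubalgebra K L) [H.IsCartanSubalgebra] (P : Set H.root) :
    Submodule K L :=
  H.toSubmodule ⊔ ⨆ α ∈ P, (rootSpace H α.1).toSubmodule

end RootSubspaces

section Subalgebras

variable {K L : Type*} [Field K] [CharZero K] [IsAlgClosed K] [LieRing L] [LieAlgebra K L]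
  [FiniteDimensional K L] [IsSemisimple K L]

/-- The positive roots `R₊` relative to a base: the roots which are sums of simple roots. -/
def positiveRoots {H : LieSubalgebra K L} [H.IsCartanSubalgebra] (B : (rootSystem H).Base) :
    Set H.root :=
  {α | (rootSystem H).root α ∈ AddSubmonoid.closure ((rootSystem H).root '' B.support)}

/-- The roots `R ∩ ℤS`, for a set `S` of (simple) roots. -/
def rootsSpannedBy {H : LieSubalgebra K L} [H.IsCartanSubalgebra] (S : Set H.root) :
    Set H.root :=
  {α | (rootSystem H).root α ∈ AddSubgroup.closure ((rootSystem H).root '' S)}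

/-- A Borel subalgebra: `H ⊕ L^{R₊}`, for some Cartan subalgebra `H` and some base of the root
system of `(L, H)`. -/
def IsBorel (b : LieSubalgebra K L) : Prop :=
  ∃ (H : LieSubalgebra K L) (_ : H.IsCartanSubalgebra) (B : (rootSystem H).Base),
    b.toSubmodule = cartanSum H (positiveRoots B)

/-- A parabolic subalgebra: one that contains a Borel subalgebra. -/
def IsParabolic (p : LieSubalgebra K L) : Prop :=
  ∃ b : LieSubalgebra K L, IsBorel b ∧ b ≤ p

/-- Two subalgebras are weakly opposite if their sum, as vector spaces, is everything. -/
def WeaklyOpposite (p p' : LieSubalgebra K L) : Prop :=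
  p.toSubmodule ⊔ p'.toSubmodule = ⊤

/-- A special (seaweed) subalgebra: the intersection of two weakly opposite parabolic
subalgebras. -/
def IsSpecial (q : LieSubalgebra K L) : Prop :=
  ∃ p p' : LieSubalgebra K L, IsParabolic p ∧ IsParabolic p' ∧ WeaklyOpposite p p' ∧ q = p ⊓ p'

/-- A Levi subalgebra of `L` (a Levi factor of a parabolic subalgebra): a subalgebra of the form
`H ⊕ ⨁ α ∈ R ∩ ℤS, L^α`, for some Cartan subalgebra `H`, some base of the root system
of `(L, H)` and some subset `S` of that base. -/
def IsLevi (l : LieSubalgebra K L) : Prop :=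
  ∃ (H : LieSubalgebra K L) (_ : H.IsCartanSubalgebra) (B : (rootSystem H).Base)
    (S : Set H.root), S ⊆ B.support ∧ l.toSubmodule = cartanSum H (rootsSpannedBy S)

end Subalgebras

end SpecialSubalgebra

/-! A Borel subalgebra is encoded by a regular grading element `x`: it is `b = upper K x 0`, with
nilpotent radical `n = upper K x 1`. Let `q = p ⊓ p'`.

Common Cartan subalgebra. Among the Borels `b ⊆ p`, `b' ⊆ p'` choose a pair with `n ∩ n'` of least
dimension. Moving `b` by `exp (t ad y)` with `y ∈ p` cannot decrease this dimension, so to first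
order `[y, a] ∈ n + n'` for every `a ∈ n ∩ n'`. The same holds for `y ∈ p'`, hence for all `y`, as
`p + p'` is everything. Since `n + n'` is Killing-orthogonal to `b ∩ b'`, the latter centralizes
`a`. But `b ∩ b'` contains an element congruent to `x` modulo `n`, which multiplies the lowest
component of `a` by a positive integer. So `n ∩ n' = 0`, and `b ∩ b'` is a Cartan subalgebra `H` for
which `p` contains the positive and `p'` the negative root spaces (`exists_upper_one_inf_eq_bot`,
`exists_cartan_of_upper_one_inf_eq_bot`). No conjugacy theorem is used.

Upper bound. Now `q = H ⊕ u ⊕ u'`, with `u` positive and `u'` negative. Kostant's cascade of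
strongly orthogonal roots gives forms `F` on `u` and `F'` on `u'` for which an isotropic vector is
determined by the form it induces on `H` (`IsClosedPositive.exists_dual`). Rescaling by degree
degenerates the bracket form of `F + F'` to one that only pairs degrees of the same sign; the rank
can only drop in the limit, so the kernel of the limit bounds the index (`exists_contraction`). Let
`E`, `E'` be the spaces of forms on `H` induced by isotropic vectors. The kernel projects to `H`
into the annihilator of `E + E'`, and the kernel of that projection embeds in `E ∩ E'`. Hence `χ(q)
≤ rk - dim (E + E') + dim (E ∩ E') ≤ rk`.

Equality. Then `E = E'`. If a root of `u` had its negative outside `p`, one of greatest height, `ε`,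
would be central in `u`, so `ε ∈ E`. All roots of `u'` vanish on a Cartan element that cuts out the
Levi factor of `p`, hence so does `E'`, whereas `ε` does not. So the roots of `q` are symmetric and
`q` is Levi.

Converse. A Levi subalgebra is the centralizer of a grading element `z`. A form on it is given by
the Killing form and some `w ∈ q`, and its kernel contains the centralizer of `w` in `q`. That
contains the centralizer in `L` of `w + t z` for generic `t`, whose dimension is at least the rank.
-/

namespace SpecialSubalgebra

open LieAlgebra LieAlgebra.IsKilling Module

set_option linter.unusedSectionVars false

/-! ### Semicontinuity of the rank in polynomial families -/

section PolynomialFamily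

variable {K V W U : Type*} [Field K] [AddCommGroup V] [Module K V] [AddCommGroup W] [Module K W]
  [AddCommGroup U] [Module K U]

/-- A family of linear maps all of whose matrix coefficients are polynomial in the parameter. -/
def IsPolynomialFamily (A : K → V →ₗ[K] W) : Prop :=
  ∀ (v : V) (φ : Dual K W), ∃ p : Polynomial K, ∀ t, φ (A t v) = p.eval t

namespace IsPolynomialFamily

lemma const (A : V →ₗ[K] W) : IsPolynomialFamily fun _ : K => A :=
  fun v φ => ⟨Polynomial.C (φ (A v)), fun t => by simp⟩

lemma add {A B : K → V →ₗ[K] W} (hA : IsPolynomialFamily A) (hB : IsPolynomialFamily B) :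
    IsPolynomialFamily fun t => A t + B t := fun v φ => by
  obtain ⟨p, hp⟩ := hA v φ
  obtain ⟨q, hq⟩ := hB v φ
  exact ⟨p + q, fun t => by simp [hp, hq]⟩

lemma eval_smul {A : K → V →ₗ[K] W} (hA : IsPolynomialFamily A) (p : Polynomial K) :
    IsPolynomialFamily fun t => p.eval t • A t := fun v φ => by
  obtain ⟨q, hq⟩ := hA v φ
  exact ⟨p * q, fun t => by simp [hq]⟩

lemma sum {ι : Type*} (s : Finset ι) {A : ι → K → V →ₗ[K] W}
    (hA : ∀ i ∈ s, IsPolynomialFamily (A i)) : IsPolynomialFamily fun t => ∑ i ∈ s, A i t := by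
  classical
  induction s using Finset.induction_on with
  | empty => simpa using const (K := K) (0 : V →ₗ[K] W)
  | insert i s hi ih =>
    simp only [Finset.sum_insert hi]
    exact (hA i (by simp)).add (ih fun j hj => hA j (by simp [hj]))

lemma comp [FiniteDimensional K W] {A : K → W →ₗ[K] U} {B : K → V →ₗ[K] W}
    (hA : IsPolynomialFamily A) (hB : IsPolynomialFamily B) :
    IsPolynomialFamily fun t => A t ∘ₗ B t := fun v φ => by
  let b := Module.finBasis K W
  choose p hp using fun i => hA (b i) φ
  choose q hq using fun i => hB v (b.coord i)
  refine ⟨∑ i, q i * p i, fun t => ?_⟩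
  have h : B t v = ∑ i, b.coord i (B t v) • b i := (b.sum_repr _).symm
  rw [LinearMap.comp_apply, h, map_sum, map_sum, Polynomial.eval_finsetSum]
  simp [hp, ← hq]

lemma pow [FiniteDimensional K V] {A : K → V →ₗ[K] V} (hA : IsPolynomialFamily A) (n : ℕ) :
    IsPolynomialFamily fun t => (A t ^ n : Module.End K V) := by
  induction n with
  | zero => simpa using const (K := K) (1 : Module.End K V)
  | succ n ih => simpa only [pow_succ, Module.End.mul_eq_comp] using ih.comp hA

/-- Lower semicontinuity of the rank. -/
lemma finite_setOf_finrank_range_lt [FiniteDimensional K W] {A : K → V →ₗ[K] W}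
    (hA : IsPolynomialFamily A) (t₀ : K) :
    {t | finrank K (LinearMap.range (A t)) < finrank K (LinearMap.range (A t₀))}.Finite := by
  set r := finrank K (LinearMap.range (A t₀)) with hr
  let b : Basis (Fin r) K (LinearMap.range (A t₀)) := Module.finBasis K _
  choose v hv using fun i => (b i).2
  obtain ⟨π, hπ⟩ := (LinearMap.range (A t₀)).subtype.exists_leftInverse_of_injective
    (LinearMap.ker_eq_bot.mpr (Submodule.injective_subtype _))
  choose P hP using fun i j => hA (v j) (b.coord i ∘ₗ π)
  -- A minor of `A t`, in coordinates that make it the identity at `t₀`.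
  let M : Matrix (Fin r) (Fin r) (Polynomial K) := Matrix.of P
  have hM (t : K) : M.det.eval t =
      (Matrix.of fun i j => (b.coord i ∘ₗ π) (A t (v j))).det := by
    rw [← Polynomial.coe_evalRingHom, RingHom.map_det]
    congr 1
    ext i j
    simp [M, hP]
  have h₀ : M.det.eval t₀ = 1 := by
    rw [hM, ← Matrix.det_one (n := Fin r)]
    congr 1
    ext i j
    have : π (A t₀ (v j)) = b j := by
      rw [hv]; exact LinearMap.congr_fun hπ (b j)
    simp [this, Matrix.one_apply, Finsupp.single_apply, eq_comm]
  have hne : M.det ≠ 0 := by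
    intro h; simp [h] at h₀
  refine (Polynomial.finite_setOfPred_isRoot hne).subset fun t ht => ?_
  by_contra hroot
  refine (not_lt.mpr ?_ : ¬ finrank K (LinearMap.range (A t)) < r) ht
  have hdet : (Matrix.of fun i j => (b.coord i ∘ₗ π) (A t (v j))).det ≠ 0 := by
    rw [← hM]; exact hroot
  have hli := Matrix.linearIndependent_cols_of_det_ne_zero hdet
  have hli' : LinearIndependent K fun j => A t (v j) := by
    refine LinearIndependent.of_comp (LinearMap.pi fun i => b.coord i ∘ₗ π) ?_
    exact hli
  have hli'' : LinearIndependent K fun j => (⟨A t (v j), ⟨_, rfl⟩⟩ : LinearMap.range (A t)) :=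
    LinearIndependent.of_comp (LinearMap.range (A t)).subtype hli'
  simpa using hli''.fintype_card_le_finrank

/-- If the rank of a polynomial family is maximal at `0`, then its derivative at `0` maps the
kernel of its value at `0` to the range of that value. -/
lemma derivative_mem_range [Infinite K] [FiniteDimensional K V] [FiniteDimensional K W]
    {A A' : K → V →ₗ[K] W}
    (hA' : IsPolynomialFamily A') (h : ∀ t, A t = A 0 + t • A' t)
    (hmax : ∀ t, finrank K (LinearMap.range (A t)) ≤ finrank K (LinearMap.range (A 0)))
    {a : V} (ha : A 0 a = 0) : A' 0 a ∈ LinearMap.range (A 0) := by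
  by_contra hmem
  -- Adjoining `A' t a` to the range raises the rank at `0`, but for `t ≠ 0` it adds nothing,
  -- because `A t a = t • A' t a`. Semicontinuity for `B` then contradicts the maximality of the
  -- rank at `0`.
  let B : K → V × K →ₗ[K] W := fun t =>
    (A 0 + (Polynomial.X : Polynomial K).eval t • A' t) ∘ₗ LinearMap.fst K V K +
      A' t ∘ₗ (LinearMap.toSpanSingleton K V a ∘ₗ LinearMap.snd K V K)
  have hB : IsPolynomialFamily B :=
    (((const _).add (hA'.eval_smul _)).comp (const _)).add (hA'.comp (const _))
  have hB' (t : K) (v : V) (c : K) : B t (v, c) = A t v + c • A' t a := by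
    simp [B, h t]
  have hlt : finrank K (LinearMap.range (A 0)) < finrank K (LinearMap.range (B 0)) := by
    refine Submodule.finrank_lt_finrank_of_lt (lt_of_le_of_ne ?_ ?_)
    · rintro _ ⟨v, rfl⟩
      exact ⟨(v, 0), by simp [hB']⟩
    · intro heq
      exact hmem (heq ▸ ⟨(0, 1), by simp [hB']⟩)
  obtain ⟨t, ht⟩ := ((hB.finite_setOf_finrank_range_lt 0).union
    (Set.finite_singleton (0 : K))).exists_notMem
  simp only [Set.mem_union, Set.mem_ofPred_eq, Set.mem_singleton_iff, not_or, not_lt] at ht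
  refine absurd (hlt.trans_le (ht.1.trans (Submodule.finrank_mono ?_))) (not_lt.mpr (hmax t))
  rintro _ ⟨⟨v, c⟩, rfl⟩
  refine ⟨v + (c * t⁻¹) • a, ?_⟩
  have : A t a = t • A' t a := by rw [h t]; simp [ha]
  rw [hB', map_add, map_smul, this, smul_smul, mul_assoc, inv_mul_cancel₀ ht.2, mul_one]

end IsPolynomialFamily

end PolynomialFamily

/-! ### Integer gradings and their filtrations -/

section Grading

variable (K : Type*) {L : Type*} [Field K] [LieRing L] [LieAlgebra K L]

/-- The eigenspace of `ad x` for the integer `i`. -/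
def gradedPart (x : L) (i : ℤ) : Submodule K L :=
  (ad K L x).eigenspace (i : K)

variable {K}

lemma mem_gradedPart {x v : L} {i : ℤ} : v ∈ gradedPart K x i ↔ ⁅x, v⁆ = (i : K) • v := by
  rw [gradedPart, Module.End.mem_eigenspace_iff, ad_apply]

variable (K) in
/-- The element `x` is a grading element if `L` is the sum of the eigenspaces of `ad x` for integer
eigenvalues. -/
def IsGrading (x : L) : Prop :=
  ⨆ i : ℤ, gradedPart K x i = ⊤

variable (K) in
/-- The sum of the eigenspaces of `ad x` for integers at least `k`. -/
def upper (x : L) (k : ℤ) : Submodule K L :=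
  ⨆ i : ℤ, ⨆ _ : k ≤ i, gradedPart K x i

lemma gradedPart_le_upper (x : L) {k i : ℤ} (h : k ≤ i) : gradedPart K x i ≤ upper K x k :=
  le_iSup₂_of_le i h le_rfl

lemma upper_mono (x : L) {k l : ℤ} (h : k ≤ l) : upper K x l ≤ upper K x k :=
  iSup₂_le fun _ hi => gradedPart_le_upper x (h.trans hi)

lemma upper_induction {x : L} {k : ℤ} {p : (v : L) → v ∈ upper K x k → Prop}
    (h₀ : p 0 (zero_mem _))
    (hadd : ∀ u v hu hv, p u hu → p v hv → p (u + v) (add_mem hu hv))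
    (h : ∀ i (hi : k ≤ i) v (hv : v ∈ gradedPart K x i), p v (gradedPart_le_upper x hi hv))
    {v : L} (hv : v ∈ upper K x k) : p v hv := by
  suffices ∃ hv, p v hv from this.2
  have hv' := hv
  rw [upper, iSup_subtype'] at hv'
  refine Submodule.iSup_induction _ (motive := fun v => ∃ hv, p v hv) hv' ?_ ⟨_, h₀⟩ ?_
  · exact fun i v hv => ⟨_, h i.1 i.2 v hv⟩
  · rintro u v ⟨hu, hu'⟩ ⟨hv, hv'⟩
    exact ⟨_, hadd u v hu hv hu' hv'⟩

lemma lie_mem_gradedPart {x u v : L} {i j : ℤ} (hu : u ∈ gradedPart K x i)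
    (hv : v ∈ gradedPart K x j) : ⁅u, v⁆ ∈ gradedPart K x (i + j) := by
  rw [mem_gradedPart] at *
  rw [leibniz_lie, hu, hv, smul_lie, lie_smul, ← add_smul, Int.cast_add]

lemma lie_mem_upper {x u v : L} {k l : ℤ} (hu : u ∈ upper K x k) (hv : v ∈ upper K x l) :
    ⁅u, v⁆ ∈ upper K x (k + l) := by
  induction hu using upper_induction with
  | h₀ => simp
  | hadd _ _ _ _ h₁ h₂ => rw [add_lie]; exact add_mem h₁ h₂
  | h i hi u hu =>
    induction hv using upper_induction with
    | h₀ => simp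
    | hadd _ _ _ _ h₁ h₂ => rw [lie_add]; exact add_mem h₁ h₂
    | h j hj v hv => exact gradedPart_le_upper x (by lia) (lie_mem_gradedPart hu hv)

lemma self_mem_gradedPart (x : L) : x ∈ gradedPart K x 0 := by
  simp [mem_gradedPart]

lemma self_mem_upper (x : L) : x ∈ upper K x 0 :=
  gradedPart_le_upper x le_rfl (self_mem_gradedPart x)

lemma gradedPart_neg (x : L) (i : ℤ) : gradedPart K (-x) i = gradedPart K x (-i) := by
  ext v
  rw [mem_gradedPart, mem_gradedPart, neg_lie, Int.cast_neg, neg_smul, neg_eq_iff_eq_neg]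

lemma gradedPart_map (e : L ≃ₗ⁅K⁆ L) (x : L) (i : ℤ) :
    gradedPart K (e x) i = (gradedPart K x i).map (e : L →ₗ[K] L) := by
  ext v
  rw [Submodule.mem_map]
  constructor
  · intro hv
    refine ⟨e.symm v, ?_, by simp⟩
    rw [mem_gradedPart] at *
    apply e.injective
    simpa using hv
  · rintro ⟨w, hw, rfl⟩
    rw [mem_gradedPart] at *
    have h := congr(e $hw)
    rwa [LieEquiv.map_lie, map_smul] at h

lemma upper_map (e : L ≃ₗ⁅K⁆ L) (x : L) (k : ℤ) :
    upper K (e x) k = (upper K x k).map (e : L →ₗ[K] L) := by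
  simp only [upper, gradedPart_map, Submodule.map_iSup]

namespace IsGrading

lemma neg {x : L} (hx : IsGrading K x) : IsGrading K (-x) := by
  rw [IsGrading] at *
  rw [← hx, ← (Equiv.neg ℤ).iSup_comp]
  simp [gradedPart_neg]

lemma map {x : L} (hx : IsGrading K x) (e : L ≃ₗ⁅K⁆ L) : IsGrading K (e x) := by
  rw [IsGrading] at *
  simp_rw [gradedPart_map, ← Submodule.map_iSup, hx, Submodule.map_top]
  exact LinearMap.range_eq_top.mpr e.surjective

lemma induction {x : L} (hx : IsGrading K x) {p : L → Prop} (h₀ : p 0) (hadd : ∀ u v, p u → p v → p (u + v))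
    (h : ∀ i, ∀ v ∈ gradedPart K x i, p v) (v : L) : p v := by
  have hv : v ∈ ⨆ i : ℤ, gradedPart K x i := by rw [show _ = _ from hx]; trivial
  exact Submodule.iSup_induction _ (motive := p) hv h h₀ hadd

variable [CharZero K]

lemma isInternal {x : L} (hx : IsGrading K x) : DirectSum.IsInternal (gradedPart K x) := by
  refine DirectSum.isInternal_submodule_of_iSupIndep_of_iSup_eq_top ?_ hx
  exact (Module.End.eigenspaces_iSupIndep (ad K L x)).comp (f := fun i : ℤ => (i : K))
    Int.cast_injective

/-- A grading element identifies `L` with the direct sum of its graded parts. -/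
noncomputable def equiv {x : L} (hx : IsGrading K x) :
    (DirectSum ℤ fun i => gradedPart K x i) ≃ₗ[K] L :=
  LinearEquiv.ofBijective (DirectSum.coeLinearMap (gradedPart K x)) hx.isInternal

/-- The projection on the `i`-th graded part. -/
noncomputable def proj {x : L} (hx : IsGrading K x) (i : ℤ) : L →ₗ[K] L :=
  (gradedPart K x i).subtype ∘ₗ DirectSum.component K ℤ (fun i => gradedPart K x i) i ∘ₗ
    hx.equiv.symm.toLinearMap

variable {x : L}

lemma proj_mem (hx : IsGrading K x) (i : ℤ) (v : L) : hx.proj i v ∈ gradedPart K x i :=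
  Subtype.prop _

lemma equiv_symm_apply_of_mem (hx : IsGrading K x) {i : ℤ} {v : L} (hv : v ∈ gradedPart K x i) :
    hx.equiv.symm v = DirectSum.lof K ℤ (fun i => gradedPart K x i) i ⟨v, hv⟩ := by
  rw [LinearEquiv.symm_apply_eq]
  exact (DirectSum.coeLinearMap_lof (gradedPart K x) i ⟨v, hv⟩).symm

lemma proj_of_mem (hx : IsGrading K x) {i : ℤ} {v : L} (hv : v ∈ gradedPart K x i) : hx.proj i v = v := by
  simp [proj, hx.equiv_symm_apply_of_mem hv, DirectSum.component.lof_self]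

lemma proj_of_mem_of_ne (hx : IsGrading K x) {i j : ℤ} {v : L} (hv : v ∈ gradedPart K x j) (h : j ≠ i) :
    hx.proj i v = 0 := by
  simp only [proj, LinearMap.comp_apply, LinearEquiv.coe_coe, hx.equiv_symm_apply_of_mem hv]
  rw [DirectSum.component.of, dif_neg h, map_zero]

lemma proj_self_lie (hx : IsGrading K x) (i : ℤ) (v : L) : hx.proj i ⁅x, v⁆ = (i : K) • hx.proj i v := by
  induction v using hx.induction with
  | h₀ => simp
  | hadd u v hu hv => simp [hu, hv]
  | h j v hv =>
    rw [mem_gradedPart.mp hv, map_smul]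
    by_cases h : j = i
    · rw [h]
    · simp [hx.proj_of_mem_of_ne hv h]

lemma eq_zero_of_forall_proj (hx : IsGrading K x) {v : L} (h : ∀ i, hx.proj i v = 0) : v = 0 := by
  have : hx.equiv.symm v = 0 := DFinsupp.ext fun i => Subtype.ext (h i)
  simpa using this

lemma exists_bound (x : L) [FiniteDimensional K L] :
    ∃ N : ℕ, ∀ i : ℤ, N < |i| → gradedPart K x i = ⊥ := by
  have hfin : {i : ℤ | gradedPart K x i ≠ ⊥}.Finite :=
    WellFoundedGT.finite_ne_bot_of_iSupIndep
      ((Module.End.eigenspaces_iSupIndep (ad K L x)).comp (f := fun i : ℤ => (i : K))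
        Int.cast_injective)
  obtain ⟨N, hN⟩ := (hfin.image Int.natAbs).bddAbove
  refine ⟨N, fun i hi => ?_⟩
  by_contra h
  have := hN ⟨i, h, rfl⟩
  rw [Int.abs_eq_natAbs] at hi
  lia

lemma exists_sum_proj_eq (hx : IsGrading K x) [FiniteDimensional K L] :
    ∃ s : Finset ℤ, ∀ v, ∑ i ∈ s, hx.proj i v = v := by
  obtain ⟨N, hN⟩ := exists_bound (K := K) x
  refine ⟨Finset.Icc (-N) N, fun v => ?_⟩
  induction v using hx.induction with
  | h₀ => simp
  | hadd u v hu hv => simp [Finset.sum_add_distrib, hu, hv]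
  | h j v hv =>
    by_cases h : j ∈ Finset.Icc (-N : ℤ) N
    · rw [Finset.sum_eq_single_of_mem j h fun i _ hi => hx.proj_of_mem_of_ne hv hi.symm,
        hx.proj_of_mem hv]
    · rw [Finset.mem_Icc, ← abs_le, not_le] at h
      rw [hN j h, Submodule.mem_bot] at hv
      simp [hv]

lemma mem_upper_iff (hx : IsGrading K x) {k : ℤ} {v : L} :
    v ∈ upper K x k ↔ ∀ i < k, hx.proj i v = 0 := by
  constructor
  · intro hv i hi
    induction hv using upper_induction with
    | h₀ => simp
    | hadd _ _ _ _ h₁ h₂ => simp [h₁, h₂]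
    | h j hj v hv => exact hx.proj_of_mem_of_ne hv (by lia)
  · suffices ∃ w ∈ upper K x k, ∀ i, k ≤ i → hx.proj i (v - w) = 0 by
      intro h
      obtain ⟨w, hw, hvw⟩ := this
      have hw' : ∀ i < k, hx.proj i w = 0 := fun i hi => by
        clear hvw
        induction hw using upper_induction with
        | h₀ => simp
        | hadd _ _ _ _ h₁ h₂ => simp [h₁, h₂]
        | h j hj v hv => exact hx.proj_of_mem_of_ne hv (by lia)
      have : v - w = 0 := hx.eq_zero_of_forall_proj fun i => by
        by_cases hi : k ≤ i
        · exact hvw i hi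
        · simp [h i (by lia), hw' i (by lia)]
      rwa [sub_eq_zero.mp this]
    induction v using hx.induction with
    | h₀ => exact ⟨0, zero_mem _, by simp⟩
    | hadd u v hu hv =>
      obtain ⟨u', hu', h₁⟩ := hu
      obtain ⟨v', hv', h₂⟩ := hv
      refine ⟨u' + v', add_mem hu' hv', fun i hi => ?_⟩
      rw [add_sub_add_comm, map_add, h₁ i hi, h₂ i hi, add_zero]
    | h j v hv =>
      by_cases hj : k ≤ j
      · exact ⟨v, gradedPart_le_upper x hj hv, by simp⟩
      · exact ⟨0, zero_mem _, fun i hi => by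
          rw [sub_zero]; exact hx.proj_of_mem_of_ne hv (by lia)⟩

lemma sub_proj_mem_upper (hx : IsGrading K x) {k : ℤ} {v : L} (hv : v ∈ upper K x k) :
    v - hx.proj k v ∈ upper K x (k + 1) := by
  rw [hx.mem_upper_iff] at *
  intro i hi
  rw [map_sub]
  rcases eq_or_lt_of_le (Int.lt_add_one_iff.mp hi) with rfl | h
  · rw [hx.proj_of_mem (hx.proj_mem _ _), sub_self]
  · rw [hv i h, hx.proj_of_mem_of_ne (hx.proj_mem k v) (by lia), sub_zero]

/-- Taking lowest components is multiplicative, since replacing `u` or `v` by its lowest component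
changes the bracket only in degrees above `k + l`. -/
lemma proj_lie (hx : IsGrading K x) {u v : L} {k l : ℤ} (hu : u ∈ upper K x k) (hv : v ∈ upper K x l) :
    hx.proj (k + l) ⁅u, v⁆ = ⁅hx.proj k u, hx.proj l v⁆ := by
  have h₁ := lie_mem_upper (hx.sub_proj_mem_upper hu) hv
  have h₂ := lie_mem_upper (gradedPart_le_upper x le_rfl (hx.proj_mem k u))
    (hx.sub_proj_mem_upper hv)
  have h₁' := hx.mem_upper_iff.mp h₁ (k + l) (by lia)
  have h₂' := hx.mem_upper_iff.mp h₂ (k + l) (by lia)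
  rw [sub_lie, map_sub, sub_eq_zero] at h₁'
  rw [lie_sub, map_sub, sub_eq_zero] at h₂'
  rw [h₁', h₂', hx.proj_of_mem (lie_mem_gradedPart (hx.proj_mem k u) (hx.proj_mem l v))]

/-- `ad x` is diagonalizable, so an invariant subspace is the sum of its intersections with the
eigenspaces. -/
lemma proj_mem_of_invariant (hx : IsGrading K x) {q : Submodule K L} (hq : ∀ v ∈ q, ⁅x, v⁆ ∈ q) {v : L}
    (hv : v ∈ q) (i : ℤ) [FiniteDimensional K L] : hx.proj i v ∈ q := by
  have htop : ⨆ μ : K, (ad K L x).genEigenspace μ 1 = ⊤ := by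
    rw [eq_top_iff, ← show _ = _ from hx]
    exact iSup_le fun i => le_iSup (fun μ : K => (ad K L x).genEigenspace μ 1) (i : K)
  have h := Submodule.eq_iSup_inf_genEigenspace (p := q) (f := ad K L x) (k := 1)
    (fun v hv => hq v hv) htop
  rw [h] at hv
  refine Submodule.iSup_induction _ hv (motive := fun v => hx.proj i v ∈ q) ?_ (by simp) ?_
  · rintro μ v ⟨hv, hμ⟩
    replace hμ : ⁅x, v⁆ = μ • v := by simpa using Module.End.mem_eigenspace_iff.mp hμ
    by_cases hi : μ = i
    · rwa [hx.proj_of_mem (mem_gradedPart.mpr (hi ▸ hμ))]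
    · have := hx.proj_self_lie i v
      rw [hμ, map_smul, ← sub_eq_zero, ← sub_smul, smul_eq_zero, sub_eq_zero] at this
      rw [this.resolve_left hi]
      exact zero_mem _
  · intro u v hu hv
    rw [map_add]
    exact add_mem hu hv

/-- A nonzero element has a lowest nonzero component. -/
lemma exists_lowest (hx : IsGrading K x) [FiniteDimensional K L] {v : L} (hv : v ≠ 0) :
    ∃ i, v ∈ upper K x i ∧ hx.proj i v ≠ 0 := by
  obtain ⟨N, hN⟩ := exists_bound (K := K) x
  have h₁ : ∃ i, hx.proj i v ≠ 0 := by
    by_contra! h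
    exact hv (hx.eq_zero_of_forall_proj h)
  have h₂ : ∃ b : ℤ, ∀ i, hx.proj i v ≠ 0 → b ≤ i := by
    refine ⟨-N, fun i hi => ?_⟩
    by_contra h
    have := hx.proj_mem i v
    rw [hN i (by rw [lt_abs]; lia), Submodule.mem_bot] at this
    exact hi this
  obtain ⟨i, hi, hmin⟩ := Int.exists_least_of_bdd h₂ h₁
  refine ⟨i, hx.mem_upper_iff.mpr fun j hj => ?_, hi⟩
  by_contra h
  exact absurd (hmin j h) (by lia)

lemma upper_inf_gradedPart (hx : IsGrading K x) {k i : ℤ} (h : i < k) : upper K x k ⊓ gradedPart K x i = ⊥ := by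
  rw [eq_bot_iff]
  rintro v ⟨hv, hi⟩
  rw [Submodule.mem_bot, ← hx.proj_of_mem hi, hx.mem_upper_iff.mp hv i h]

/-- `ad u` raises the degree by at least one, and only degrees in `[-N, N]` occur, so `2 * N + 1`
applications give zero. -/
lemma isNilpotent_ad_of_mem_upper (hx : IsGrading K x) [FiniteDimensional K L] {u : L} (hu : u ∈ upper K x 1) :
    _root_.IsNilpotent (ad K L u) := by
  obtain ⟨N, hN⟩ := exists_bound (K := K) x
  have hstep (k : ℕ) (v : L) : ((ad K L u) ^ k) v ∈ upper K x (k - N) := by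
    induction k with
    | zero =>
      rw [hx.mem_upper_iff]
      intro i hi
      have := hx.proj_mem i ((ad K L u ^ 0) v)
      rwa [hN i (by simp at hi; rw [lt_abs]; lia), Submodule.mem_bot] at this
    | succ k ih =>
      rw [pow_succ', Module.End.mul_apply, ad_apply]
      have := lie_mem_upper hu ih
      rwa [show (1 : ℤ) + (k - N) = (k + 1 : ℕ) - N by push_cast; ring] at this
  refine ⟨2 * N + 1, LinearMap.ext fun v => hx.eq_zero_of_forall_proj fun i => ?_⟩
  by_cases hi : i < (2 * N + 1 : ℕ) - N
  · exact hx.mem_upper_iff.mp (hstep _ v) i hi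
  · have := hx.proj_mem i ((ad K L u ^ (2 * N + 1)) v)
    rwa [hN i (by push_cast at hi; rw [lt_abs]; lia), Submodule.mem_bot] at this

lemma isNilpotent_ad_of_mem_gradedPart (hx : IsGrading K x) [FiniteDimensional K L] {u : L} {i : ℤ} (hi : i < 0)
    (hu : u ∈ gradedPart K x i) : _root_.IsNilpotent (ad K L u) := by
  refine hx.neg.isNilpotent_ad_of_mem_upper (gradedPart_le_upper _ (show 1 ≤ -i by lia) ?_)
  rwa [gradedPart_neg, neg_neg]

/-- Invariance under `ad x` gives `(i + j) κ(u, v) = 0`. -/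
lemma killingForm_eq_zero {u v : L} {i j : ℤ} (hu : u ∈ gradedPart K x i)
    (hv : v ∈ gradedPart K x j) (h : i + j ≠ 0) : killingForm K L u v = 0 := by
  have h₁ : killingForm K L ⁅x, u⁆ v = - killingForm K L u ⁅x, v⁆ := by
    rw [← lie_skew, map_neg, LinearMap.neg_apply, LieModule.traceForm_apply_lie_apply]
  rw [mem_gradedPart.mp hu, mem_gradedPart.mp hv, map_smul, map_smul, LinearMap.smul_apply,
    eq_neg_iff_add_eq_zero, ← add_smul, ← Int.cast_add, smul_eq_zero] at h₁
  exact h₁.resolve_left (by exact_mod_cast h)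

lemma killingForm_eq_zero_of_mem_upper {u v : L} {k l : ℤ} (hu : u ∈ upper K x k)
    (hv : v ∈ upper K x l) (h : 0 < k + l) : killingForm K L u v = 0 := by
  induction hu using upper_induction with
  | h₀ => simp
  | hadd _ _ _ _ h₁ h₂ => simp [h₁, h₂]
  | h i hi u hu =>
    induction hv using upper_induction with
    | h₀ => simp
    | hadd _ _ _ _ h₁ h₂ => simp [h₁, h₂]
    | h j hj v hv => exact killingForm_eq_zero hu hv (by lia)

lemma killingForm_proj (hx : IsGrading K x) (u v : L) (i : ℤ) :
    killingForm K L (hx.proj i u) v = killingForm K L u (hx.proj (-i) v) := by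
  induction u using hx.induction with
  | h₀ => simp
  | hadd _ _ h₁ h₂ => simp [h₁, h₂]
  | h j u hu =>
    induction v using hx.induction with
    | h₀ => simp
    | hadd _ _ h₁ h₂ => simp [h₁, h₂]
    | h k v hv =>
      by_cases hj : j = i
      · by_cases hk : k = -i
        · rw [hx.proj_of_mem (hj ▸ hu), hx.proj_of_mem (hk ▸ hv)]
        · rw [hx.proj_of_mem_of_ne hv hk, hx.proj_of_mem (hj ▸ hu),
            killingForm_eq_zero hu hv (by lia), map_zero]
      · rw [hx.proj_of_mem_of_ne hu hj, map_zero, LinearMap.zero_apply]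
        by_cases hk : k = -i
        · rw [hx.proj_of_mem (hk ▸ hv), killingForm_eq_zero hu hv (by lia)]
        · rw [hx.proj_of_mem_of_ne hv hk, map_zero]

lemma mem_upper_of_forall_killingForm (hx : IsGrading K x) [FiniteDimensional K L] [IsKilling K L] {k : ℤ} {v : L}
    (h : ∀ u ∈ upper K x k, killingForm K L v u = 0) : v ∈ upper K x (1 - k) := by
  rw [hx.mem_upper_iff]
  intro i hi
  have hker : hx.proj i v ∈ LinearMap.ker (killingForm K L) := by
    rw [LinearMap.mem_ker]
    ext u
    rw [hx.killingForm_proj, LinearMap.zero_apply]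
    exact h _ (gradedPart_le_upper x (by lia) (hx.proj_mem _ _))
  simpa using hker

lemma orthogonal_upper (hx : IsGrading K x) [FiniteDimensional K L] [IsKilling K L] (k : ℤ) :
    (killingForm K L).orthogonal (upper K x k) = upper K x (1 - k) := by
  ext v
  rw [LinearMap.BilinForm.mem_orthogonal_iff]
  constructor
  · intro h
    refine hx.mem_upper_of_forall_killingForm fun u hu => ?_
    rw [LieModule.traceForm_comm]
    exact h u hu
  · intro hv u hu
    exact killingForm_eq_zero_of_mem_upper hu hv (by lia)

end IsGrading

end Grading

/-! ### One-parameter groups of automorphisms -/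

section Exponential

variable {K L : Type*} [Field K] [CharZero K] [LieRing L] [LieAlgebra K L]

/-- The one-parameter group of automorphisms attached to an `ad`-nilpotent element. -/
lemma exists_lieEquiv_exp {y : L} (hy : _root_.IsNilpotent (ad K L y)) :
    ∃ (n : ℕ) (e : K → L ≃ₗ⁅K⁆ L), ∀ t v,
      e t v = ∑ k ∈ Finset.range (n + 2), (t ^ k * (k.factorial : K)⁻¹) • ((ad K L y) ^ k) v := by
  let _ : Module ℚ L := Module.compHom L (algebraMap ℚ K)
  let _ : LieAlgebra ℚ L := { lie_smul := fun q u v => lie_smul (q : K) u v }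
  obtain ⟨n, hn⟩ := hy
  have had (t : K) : (LieDerivation.ad K L (t • y)).toLinearMap = t • ad K L y := by
    ext v; simp
  -- The exponent `n + 2` in place of `n` ensures that the constant and the linear term are always
  -- present in the sum.
  have hpow (t : K) : ((LieDerivation.ad K L (t • y)).toLinearMap) ^ (n + 2) = 0 := by
    rw [had, smul_pow, pow_add (ad K L y), hn, zero_mul, smul_zero]
  have hnil (t : K) : _root_.IsNilpotent (LieDerivation.ad K L (t • y)).toLinearMap :=
    ⟨n + 2, hpow t⟩
  refine ⟨n, fun t => LieDerivation.exp _ (hnil t), fun t v => ?_⟩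
  beta_reduce
  rw [LieDerivation.exp_map_apply, IsNilpotent.exp_eq_sum (hpow t), LinearMap.sum_apply]
  refine Finset.sum_congr rfl fun k _ => ?_
  rw [had, smul_pow, LinearMap.smul_apply, LinearMap.smul_apply, mul_comm, mul_smul]
  change (((k.factorial : ℚ)⁻¹ : ℚ) : K) • (t ^ k • (ad K L y ^ k) v) = _
  simp

end Exponential

/-! ### Regular gradings and the relative position of two Borel subalgebras -/

section RegularGrading

variable {K L : Type*} [Field K] [LieRing L] [LieAlgebra K L]

variable (K) in
/-- A grading element whose centralizer is commutative. -/
structure IsRegularGrading (x : L) : Prop where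
  isGrading : IsGrading K x
  lie_eq_zero : ∀ u ∈ gradedPart K x 0, ∀ v ∈ gradedPart K x 0, ⁅u, v⁆ = 0

/-- If `w` normalizes `H`, then `⁅z, w⁆` lies in the commutative `H`, so `ad z` kills `w` twice;
hence the shape of the last hypothesis. -/
lemma isCartanSubalgebra_of_abelian (H : LieSubalgebra K L) (hH : ∀ u ∈ H, ∀ v ∈ H, ⁅u, v⁆ = 0)
    {z : L} (hz : z ∈ H) (h : ∀ w, ⁅z, ⁅z, w⁆⁆ = 0 → w ∈ H) : H.IsCartanSubalgebra where
  nilpotent := by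
    have : IsLieAbelian H := ⟨fun u v => Subtype.ext (hH u u.2 v v.2)⟩
    infer_instance
  self_normalizing := by
    refine le_antisymm (fun w hw => h w (hH _ hz _ ?_)) H.le_normalizer
    rw [LieSubalgebra.mem_normalizer_iff'] at hw
    exact hw z hz

namespace IsRegularGrading

lemma map {x : L} (hx : IsRegularGrading K x) (e : L ≃ₗ⁅K⁆ L) : IsRegularGrading K (e x) where
  isGrading := hx.isGrading.map e
  lie_eq_zero := by
    rw [gradedPart_map]
    rintro _ ⟨u, hu, rfl⟩ _ ⟨v, hv, rfl⟩
    have := congr(e $(hx.lie_eq_zero u hu v hv))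
    rwa [LieEquiv.map_lie, map_zero] at this

lemma inf_sup_le {x x' : L} :
    (upper K x 0 ⊓ upper K x' 0) ⊔ upper K x 1 ≤ upper K x 0 :=
  sup_le inf_le_left (upper_mono x (by lia))

lemma finrank_orthogonal_add [FiniteDimensional K L] [IsKilling K L] (W : Submodule K L) :
    finrank K ((killingForm K L).orthogonal W) + finrank K W = finrank K L := by
  have := LinearMap.BilinForm.finrank_orthogonal (killingForm_nondegenerate K L) W
  have := Submodule.finrank_le W
  lia

variable [CharZero K]

lemma exists_isCartanSubalgebra {x : L} (hx : IsRegularGrading K x) :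
    ∃ H : LieSubalgebra K L, H.IsCartanSubalgebra ∧ H.toSubmodule = gradedPart K x 0 := by
  let H : LieSubalgebra K L :=
    { gradedPart K x 0 with
      lie_mem' := fun {u v} hu hv => by
        rw [show ⁅u, v⁆ = 0 from hx.lie_eq_zero u hu v hv]
        exact (gradedPart K x 0).zero_mem }
  refine ⟨H, isCartanSubalgebra_of_abelian H hx.lie_eq_zero (self_mem_gradedPart x) ?_, rfl⟩
  intro w hw
  refine mem_gradedPart.mpr ?_
  rw [Int.cast_zero, zero_smul]
  refine hx.isGrading.eq_zero_of_forall_proj fun i => ?_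
  have h : hx.isGrading.proj i ⁅x, ⁅x, w⁆⁆ = 0 := by rw [hw, map_zero]
  rw [hx.isGrading.proj_self_lie, smul_eq_zero] at h
  rcases h with h | h
  · rw [hx.isGrading.proj_self_lie, h, zero_smul]
  · exact h

variable [FiniteDimensional K L] [IsKilling K L]

lemma eq_zero_of_isNilpotent {x h : L} (hx : IsRegularGrading K x) (hh : h ∈ gradedPart K x 0)
    (hn : _root_.IsNilpotent (ad K L h)) : h = 0 := by
  obtain ⟨H, hH, hH'⟩ := hx.exists_isCartanSubalgebra
  exact eq_zero_of_isNilpotent_ad_of_mem_isCartanSubalgebra K L H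
    (by rwa [← LieSubalgebra.mem_toSubmodule, hH']) hn

/-- Nilpotent elements of a Borel subalgebra belong to its nilpotent radical. -/
lemma mem_upper_one_of_isNilpotent {x u : L} (hx : IsRegularGrading K x) (hu : u ∈ upper K x 0)
    (hn : _root_.IsNilpotent (ad K L u)) : u ∈ upper K x 1 := by
  suffices h : hx.isGrading.proj 0 u = 0 by
    have := hx.isGrading.sub_proj_mem_upper hu
    rwa [h, sub_zero, zero_add] at this
  refine hx.eq_zero_of_isNilpotent (hx.isGrading.proj_mem 0 u) ?_
  set h := hx.isGrading.proj 0 u with hh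
  -- On homogeneous vectors the powers of `ad h` are the lowest components of those of `ad u`, so
  -- `ad h` inherits nilpotency.
  have key (k : ℕ) (j : ℤ) (v : L) (hv : v ∈ gradedPart K x j) :
      (ad K L u ^ k) v ∈ upper K x j ∧
        hx.isGrading.proj j ((ad K L u ^ k) v) = (ad K L h ^ k) v := by
    induction k with
    | zero => exact ⟨gradedPart_le_upper x le_rfl hv, hx.isGrading.proj_of_mem hv⟩
    | succ k ih =>
      rw [pow_succ', Module.End.mul_apply, ad_apply, pow_succ', Module.End.mul_apply, ad_apply]
      have h₁ := lie_mem_upper hu ih.1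
      have h₂ := hx.isGrading.proj_lie hu ih.1
      rw [zero_add] at h₁ h₂
      exact ⟨h₁, by rw [h₂, ih.2]⟩
  obtain ⟨k, hk⟩ := hn
  refine ⟨k, LinearMap.ext fun v => ?_⟩
  induction v using hx.isGrading.induction with
  | h₀ => simp
  | hadd u v hu hv => simp [hu, hv]
  | h j v hv => rw [← (key k j v hv).2, hk]; simp

lemma upper_one_inf_upper_zero_le {x x' : L} (hx : IsGrading K x) (hx' : IsRegularGrading K x') :
    upper K x 1 ⊓ upper K x' 0 ≤ upper K x' 1 :=
  fun _ hu => hx'.mem_upper_one_of_isNilpotent hu.2 (hx.isNilpotent_ad_of_mem_upper hu.1)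

lemma upper_zero_inf_eq_orthogonal {x x' : L} (hx : IsGrading K x) (hx' : IsGrading K x') :
    upper K x 0 ⊓ upper K x' 0 =
      (killingForm K L).orthogonal (upper K x 1 ⊔ upper K x' 1) := by
  have h := hx.orthogonal_upper 1
  have h' := hx'.orthogonal_upper 1
  rw [sub_self] at h h'
  rw [← h, ← h']
  refine le_antisymm (fun v hv => ?_) (le_inf (LinearMap.BilinForm.orthogonal_le le_sup_left)
    (LinearMap.BilinForm.orthogonal_le le_sup_right))
  rw [LinearMap.BilinForm.mem_orthogonal_iff]
  intro u hu
  obtain ⟨a, ha, b, hb, rfl⟩ := Submodule.mem_sup.mp hu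
  have h₁ := hv.1 a ha
  have h₂ := hv.2 b hb
  rw [map_add, LinearMap.add_apply, h₁, h₂, add_zero]

lemma finrank_upper_zero_add {x : L} (hx : IsGrading K x) :
    finrank K (upper K x 0) + finrank K (upper K x 1) = finrank K L := by
  have := finrank_orthogonal_add (upper K x 1)
  rwa [hx.orthogonal_upper, sub_self] at this

/-- With `b`, `n` and `b'`, `n'` the Borels and their radicals: `b ∩ b'` is the orthogonal of `n +
n'`, and it meets `n` exactly in `n ∩ n'`, because nilpotent elements of `b'` lie in `n'`. The two
occurrences of `dim (n ∩ n')` cancel. -/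
lemma finrank_inf_sup {x x' : L} (hx : IsRegularGrading K x) (hx' : IsRegularGrading K x') :
    finrank K ↥((upper K x 0 ⊓ upper K x' 0) ⊔ upper K x 1) + finrank K (upper K x' 1) =
      finrank K L := by
  have h₁ := finrank_orthogonal_add (upper K x 1 ⊔ upper K x' 1)
  rw [← upper_zero_inf_eq_orthogonal hx.isGrading hx'.isGrading] at h₁
  have h₂ := Submodule.finrank_sup_add_finrank_inf_eq (upper K x 1) (upper K x' 1)
  have h₃ := Submodule.finrank_sup_add_finrank_inf_eq (upper K x 0 ⊓ upper K x' 0) (upper K x 1)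
  have h₄ : (upper K x 0 ⊓ upper K x' 0) ⊓ upper K x 1 = upper K x 1 ⊓ upper K x' 1 := by
    apply le_antisymm
    · exact le_inf inf_le_right ((le_inf inf_le_right (inf_le_left.trans inf_le_right)).trans
        (upper_one_inf_upper_zero_le hx.isGrading hx'))
    · exact le_inf (le_inf (inf_le_left.trans (upper_mono x (by lia)))
        (inf_le_right.trans (upper_mono x' (by lia)))) inf_le_left
  rw [h₄] at h₃
  lia

lemma finrank_upper_one_le {x x' : L} (hx : IsRegularGrading K x) (hx' : IsRegularGrading K x') :
    finrank K (upper K x 1) ≤ finrank K (upper K x' 1) := by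
  have h₁ := finrank_inf_sup hx hx'
  have h₂ := Submodule.finrank_mono (inf_sup_le (K := K) (x := x) (x' := x'))
  have h₃ := finrank_upper_zero_add hx.isGrading
  lia

lemma finrank_upper_one_eq {x x' : L} (hx : IsRegularGrading K x) (hx' : IsRegularGrading K x') :
    finrank K (upper K x 1) = finrank K (upper K x' 1) :=
  le_antisymm (finrank_upper_one_le hx hx') (finrank_upper_one_le hx' hx)

/-- The inclusion is an equality by dimension, since all radicals `n` have the same dimension. This
replaces the Bruhat decomposition: modulo `n`, all of `b` is visible in `b ∩ b'`, however the two
Borels are placed. -/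
lemma inf_sup_eq {x x' : L} (hx : IsRegularGrading K x) (hx' : IsRegularGrading K x') :
    (upper K x 0 ⊓ upper K x' 0) ⊔ upper K x 1 = upper K x 0 := by
  refine Submodule.eq_of_le_of_finrank_le inf_sup_le ?_
  have h₁ := finrank_inf_sup hx hx'
  have h₂ := finrank_upper_zero_add hx.isGrading
  have h₃ := finrank_upper_one_eq hx hx'
  lia

lemma finrank_gradedPart_zero_add {x : L} (hx : IsGrading K x) :
    finrank K (gradedPart K x 0) + 2 * finrank K (upper K x 1) = finrank K L := by
  have h₁ := finrank_upper_zero_add hx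
  have h₂ := Submodule.finrank_sup_add_finrank_inf_eq (upper K x 1) (gradedPart K x 0)
  rw [hx.upper_inf_gradedPart (by lia), finrank_bot] at h₂
  have h₃ : upper K x 1 ⊔ gradedPart K x 0 = upper K x 0 := by
    refine le_antisymm (sup_le (upper_mono x (by lia)) (gradedPart_le_upper x le_rfl)) ?_
    intro v hv
    exact Submodule.mem_sup.mpr ⟨_, by simpa using hx.sub_proj_mem_upper hv, _,
      hx.proj_mem 0 v, by simp⟩
  rw [h₃] at h₂
  lia

/-- The centralizers of regular grading elements all have the same dimension. -/
lemma finrank_gradedPart_zero_eq {x x' : L} (hx : IsRegularGrading K x)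
    (hx' : IsRegularGrading K x') :
    finrank K (gradedPart K x 0) = finrank K (gradedPart K x' 0) := by
  have h₁ := finrank_gradedPart_zero_add hx.isGrading
  have h₂ := finrank_gradedPart_zero_add hx'.isGrading
  have h₃ := finrank_upper_one_eq hx hx'
  lia

end IsRegularGrading

end RegularGrading

/-! ### Existence of opposite Borel subalgebras -/

section OppositeBorels

variable {K L : Type*} [Field K] [LieRing L] [LieAlgebra K L]

lemma finrank_ker_mkQ_comp (e : L ≃ₗ⁅K⁆ L) (x x' : L) :
    finrank K (LinearMap.ker ((upper K x' 1).mkQ ∘ₗ (e : L →ₗ[K] L) ∘ₗ (upper K x 1).subtype)) =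
      finrank K ↥(upper K (e x) 1 ⊓ upper K x' 1) := by
  rw [← Submodule.finrank_map_subtype_eq, ← LinearEquiv.finrank_map_eq e.toLinearEquiv]
  refine congrArg (fun W : Submodule K L => finrank K W) ?_
  rw [upper_map]
  ext v
  simp only [Submodule.mem_map, LinearMap.mem_ker, Submodule.mem_inf]
  constructor
  · rintro ⟨_, ⟨⟨u, hu⟩, hu', rfl⟩, rfl⟩
    exact ⟨⟨u, hu, rfl⟩, by simpa using hu'⟩
  · rintro ⟨⟨u, hu, rfl⟩, hv⟩
    exact ⟨u, ⟨⟨u, hu⟩, by simpa using hv, rfl⟩, rfl⟩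

variable [CharZero K] [FiniteDimensional K L]

/-- First variation of the minimality condition. Along `exp (t ad y)` the maps from `n` to `L / n'`
have rank maximal at `t = 0`, so their derivative there sends the kernel `n ∩ n'` into the range,
the image of `n`. -/
lemma lie_mem_sup_of_minimal_of_neg {x x' : L} (hx : IsRegularGrading K x)
    {p : LieSubalgebra K L} (hp : upper K x 0 ≤ p.toSubmodule)
    (hmin : ∀ w : L, IsRegularGrading K w → upper K w 0 ≤ p.toSubmodule →
      finrank K ↥(upper K x 1 ⊓ upper K x' 1) ≤ finrank K ↥(upper K w 1 ⊓ upper K x' 1))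
    {y a : L} {i : ℤ} (hi : i < 0) (hyi : y ∈ gradedPart K x i)
    (hyp : y ∈ p) (ha : a ∈ upper K x 1 ⊓ upper K x' 1) :
    ⁅y, a⁆ ∈ upper K x 1 ⊔ upper K x' 1 := by
  obtain ⟨n, e, he⟩ := exists_lieEquiv_exp (hx.isGrading.isNilpotent_ad_of_mem_gradedPart hi hyi)
  have hep (t : K) : upper K (e t x) 0 ≤ p.toSubmodule := by
    rw [upper_map]
    rintro _ ⟨v, hv, rfl⟩
    change e t v ∈ p.toSubmodule
    rw [he]
    refine sum_mem fun k hk => Submodule.smul_mem _ _ ?_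
    clear hk he
    induction k with
    | zero => exact hp hv
    | succ k ih =>
      rw [pow_succ', Module.End.mul_apply, ad_apply]
      exact p.lie_mem hyp ih
  let A : K → upper K x 1 →ₗ[K] L ⧸ upper K x' 1 := fun t =>
    (upper K x' 1).mkQ ∘ₗ (e t : L →ₗ[K] L) ∘ₗ (upper K x 1).subtype
  -- The difference quotient `(e t - 1) / t`, written as a polynomial so that it makes sense at `t =
  -- 0`, where it equals `ad y`.
  let D : K → L →ₗ[K] L := fun t => ∑ k ∈ Finset.range (n + 1),
    (Polynomial.C (((k + 1).factorial : K)⁻¹) * Polynomial.X ^ k : Polynomial K).eval t •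
      (ad K L y ^ (k + 1) : L →ₗ[K] L)
  let A' : K → upper K x 1 →ₗ[K] L ⧸ upper K x' 1 := fun t =>
    (upper K x' 1).mkQ ∘ₗ D t ∘ₗ (upper K x 1).subtype
  have hA' : IsPolynomialFamily A' :=
    (IsPolynomialFamily.const _).comp ((IsPolynomialFamily.sum _ fun k _ =>
      (IsPolynomialFamily.const _).eval_smul _).comp (IsPolynomialFamily.const _))
  have he' (t : K) (v : L) : e t v = v + t • D t v := by
    rw [he, Finset.sum_range_succ', add_comm]
    congr 1
    · simp
    · simp only [D, LinearMap.sum_apply, Finset.smul_sum]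
      refine Finset.sum_congr rfl fun k _ => ?_
      rw [LinearMap.smul_apply, smul_smul]
      congr 1
      simp [pow_succ]
      ring
  have hA (t : K) : A t = A 0 + t • A' t := by
    ext v
    simp [A, A', he']
  have hmax (t : K) :
      finrank K (LinearMap.range (A t)) ≤ finrank K (LinearMap.range (A 0)) := by
    have h₁ := LinearMap.finrank_range_add_finrank_ker (A t)
    have h₂ := LinearMap.finrank_range_add_finrank_ker (A 0)
    have h₃ := hmin (e t x) (hx.map (e t)) (hep t)
    rw [← finrank_ker_mkQ_comp] at h₃
    have h₄ : finrank K (LinearMap.ker (A 0)) = finrank K ↥(upper K x 1 ⊓ upper K x' 1) := by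
      rw [finrank_ker_mkQ_comp]
      have : e 0 x = x := by simp [he']
      rw [this]
    change _ ≤ finrank K (LinearMap.ker (A t)) at h₃
    lia
  have ha₀ : A 0 ⟨a, ha.1⟩ = 0 := by
    simpa [A, he'] using ha.2
  obtain ⟨v, hv⟩ := hA'.derivative_mem_range hA hmax ha₀
  have hD : D 0 a = ⁅y, a⁆ := by
    simp only [D, LinearMap.sum_apply]
    rw [Finset.sum_eq_single_of_mem 0 (by simp)]
    · simp
    · intro k _ hk
      simp [hk]
  have hv' : (upper K x' 1).mkQ v = (upper K x' 1).mkQ ⁅y, a⁆ := by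
    rw [← hD]
    simpa [A, A', he'] using hv
  rw [← sub_eq_zero, ← map_sub, ← neg_sub, map_neg, neg_eq_zero] at hv'
  have hmem : ⁅y, a⁆ - v ∈ upper K x' 1 := 
    (Submodule.ker_mkQ (upper K x' 1)).le hv'
  exact Submodule.mem_sup.mpr ⟨v, v.2, _, hmem, by simp⟩

/-- Since `x ∈ p`, the components of `y` stay in `p`. Those of nonnegative degree preserve `n`; the
others are `ad`-nilpotent and generate a deformation inside `p`. -/
lemma lie_mem_sup_of_minimal {x x' : L} (hx : IsRegularGrading K x)
    {p : LieSubalgebra K L} (hp : upper K x 0 ≤ p.toSubmodule)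
    (hmin : ∀ w : L, IsRegularGrading K w → upper K w 0 ≤ p.toSubmodule →
      finrank K ↥(upper K x 1 ⊓ upper K x' 1) ≤ finrank K ↥(upper K w 1 ⊓ upper K x' 1))
    {y a : L} (hy : y ∈ p) (ha : a ∈ upper K x 1 ⊓ upper K x' 1) :
    ⁅y, a⁆ ∈ upper K x 1 ⊔ upper K x' 1 := by
  have hxp : x ∈ p := hp (self_mem_upper x)
  obtain ⟨s, hs⟩ := hx.isGrading.exists_sum_proj_eq
  rw [← hs y, sum_lie]
  refine sum_mem fun i _ => ?_
  have hyp : hx.isGrading.proj i y ∈ p :=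
    hx.isGrading.proj_mem_of_invariant (q := p.toSubmodule) (fun v hv => p.lie_mem hxp hv) hy i
  have hyi := hx.isGrading.proj_mem i y
  rcases le_or_gt 0 i with hi | hi
  · have h := lie_mem_upper (gradedPart_le_upper x hi hyi) ha.1
    rw [zero_add] at h
    exact Submodule.mem_sup_left h
  exact lie_mem_sup_of_minimal_of_neg hx hp hmin hi hyi hyp ha

variable [IsKilling K L]

lemma exists_upper_one_inf_eq_bot {x₀ x₀' : L} (hx₀ : IsRegularGrading K x₀)
    (hx₀' : IsRegularGrading K x₀') {p p' : LieSubalgebra K L}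
    (hp : upper K x₀ 0 ≤ p.toSubmodule) (hp' : upper K x₀' 0 ≤ p'.toSubmodule)
    (hpp' : p.toSubmodule ⊔ p'.toSubmodule = ⊤) :
    ∃ x x' : L, IsRegularGrading K x ∧ IsRegularGrading K x' ∧ upper K x 0 ≤ p.toSubmodule ∧
      upper K x' 0 ≤ p'.toSubmodule ∧ upper K x 1 ⊓ upper K x' 1 = ⊥ := by
  let S : Set (L × L) := {w | IsRegularGrading K w.1 ∧ IsRegularGrading K w.2 ∧
    upper K w.1 0 ≤ p.toSubmodule ∧ upper K w.2 0 ≤ p'.toSubmodule}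
  have hS : S.Nonempty := ⟨(x₀, x₀'), hx₀, hx₀', hp, hp'⟩
  let d : L × L → ℕ := fun w => finrank K ↥(upper K w.1 1 ⊓ upper K w.2 1)
  obtain ⟨⟨x, x'⟩, ⟨hx, hx', hxp, hxp'⟩, hmin⟩ :
      ∃ w ∈ S, ∀ w' ∈ S, d w ≤ d w' := by
    obtain ⟨w, hw⟩ := exists_minimalFor_of_wellFoundedLT (· ∈ S) d hS
    exact ⟨w, hw.1, fun w' hw' => (le_total (d w) (d w')).elim id fun h => hw.2 hw' h⟩
  refine ⟨x, x', hx, hx', hxp, hxp', ?_⟩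
  rw [eq_bot_iff]
  intro a ha
  by_contra ha₀
  rw [Submodule.mem_bot] at ha₀
  have hcomm (y : L) : ⁅y, a⁆ ∈ upper K x 1 ⊔ upper K x' 1 := by
    have hy : y ∈ p.toSubmodule ⊔ p'.toSubmodule := by rw [hpp']; trivial
    obtain ⟨y₁, hy₁, y₂, hy₂, rfl⟩ := Submodule.mem_sup.mp hy
    rw [add_lie]
    refine add_mem (lie_mem_sup_of_minimal hx hxp (fun w hw hwp => ?_) hy₁ ha) ?_
    · exact hmin (w, x') ⟨hw, hx', hwp, hxp'⟩
    · rw [sup_comm]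
      rw [inf_comm] at ha
      refine lie_mem_sup_of_minimal hx' hxp' (fun w hw hwp => ?_) hy₂ ha
      rw [inf_comm, inf_comm (upper K w 1)]
      exact hmin (x, w) ⟨hx, hw, hxp, hwp⟩
  -- This `z` lies in both Borels and has lowest component `x`, so it multiplies the lowest
  -- component of `a` by its degree, which is positive. On the other hand `z` is orthogonal to `⁅L,
  -- a⁆`, which forces `⁅z, a⁆ = 0`.
  obtain ⟨z, hz, n, hn, hzn⟩ : ∃ z ∈ upper K x 0 ⊓ upper K x' 0, ∃ n ∈ upper K x 1, z + n = x := by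
    have := self_mem_upper (K := K) x
    rw [← IsRegularGrading.inf_sup_eq hx hx'] at this
    exact Submodule.mem_sup.mp this
  have hza : ⁅z, a⁆ = 0 := by
    have hker : ⁅z, a⁆ ∈ LinearMap.ker (killingForm K L) := by
      rw [LinearMap.mem_ker]
      ext y
      rw [IsRegularGrading.upper_zero_inf_eq_orthogonal hx.isGrading hx'.isGrading,
        LinearMap.BilinForm.mem_orthogonal_iff] at hz
      have := hz _ (hcomm y)
      rw [LieModule.traceForm_comm, ← lie_skew, map_neg, neg_eq_zero,
        ← LieModule.traceForm_apply_lie_apply] at this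
      simpa using this
    simpa using hker
  obtain ⟨i, hi, hia⟩ := hx.isGrading.exists_lowest ha₀
  have hi₁ : 1 ≤ i := by
    by_contra h
    exact hia (hx.isGrading.mem_upper_iff.mp ha.1 i (by lia))
  have h₁ := hx.isGrading.proj_lie hz.1 hi
  have hz₀ : hx.isGrading.proj 0 z = x := by
    rw [eq_sub_of_add_eq hzn, map_sub, hx.isGrading.mem_upper_iff.mp hn 0 (by lia), sub_zero,
      hx.isGrading.proj_of_mem (self_mem_gradedPart x)]
  rw [hza, map_zero, hz₀, mem_gradedPart.mp (hx.isGrading.proj_mem i a), eq_comm,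
    smul_eq_zero] at h₁
  rcases h₁ with h | h
  · rw [Int.cast_eq_zero] at h
    lia
  · exact hia h

end OppositeBorels

/-! ### From opposite Borel subalgebras to a Cartan subalgebra -/

section CommonCartan

variable {K L : Type*} [Field K] [CharZero K] [IsAlgClosed K] [LieRing L] [LieAlgebra K L]
  [FiniteDimensional K L] [IsKilling K L]

/-- A subspace stable under a Cartan subalgebra is the sum of its weight components. -/
lemma le_of_forall_weight (H : LieSubalgebra K L) [H.IsCartanSubalgebra] {N W : Submodule K L}
    (hN : ∀ h ∈ H, ∀ v ∈ N, ⁅h, v⁆ ∈ N)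
    (h : ∀ χ : LieModule.Weight K H L, ∀ v ∈ N, v ∈ rootSpace H χ → v ∈ W) : N ≤ W := by
  let N' : LieSubmodule K H L := { N with lie_mem := fun {x m} hm => hN x x.2 m hm }
  intro v hv
  have hv' : v ∈ N' := hv
  rw [LieModule.eq_iSup_inf_genWeightSpace (N := N')] at hv'
  refine LieSubmodule.iSup_induction _ (motive := fun v => v ∈ W) hv' ?_ W.zero_mem
    fun _ _ => W.add_mem
  rintro χ v ⟨h₁, h₂⟩
  exact h χ v h₁ h₂

lemma apply_eq_of_mem_gradedPart {H : LieSubalgebra K L} [H.IsCartanSubalgebra] {x : H}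
    {χ : H → K} {v : L} {i : ℤ} (hv : v ∈ rootSpace H χ) (hv₀ : v ≠ 0)
    (hi : v ∈ gradedPart K (x : L) i) : χ x = i := by
  have h₁ := lie_eq_smul_of_mem_rootSpace hv x
  rw [LieSubalgebra.coe_bracket_of_module, mem_gradedPart.mp hi] at h₁
  exact (smul_left_injective K hv₀ h₁).symm

lemma rootSpace_le_gradedPart {H : LieSubalgebra K L} [H.IsCartanSubalgebra] {x : H}
    {χ : H → K} {i : ℤ} (h : χ x = i) :
    (rootSpace H χ).toSubmodule ≤ gradedPart K (x : L) i := fun v hv => by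
  rw [mem_gradedPart, ← h]
  exact lie_eq_smul_of_mem_rootSpace hv x

lemma lie_eq_zero_of_mem_cartan {H : LieSubalgebra K L} [H.IsCartanSubalgebra] {u v : L}
    (hu : u ∈ H) (hv : v ∈ H) : ⁅u, v⁆ = 0 :=
  congr(Subtype.val $(trivial_lie_zero H H ⟨u, hu⟩ ⟨v, hv⟩))

lemma lie_mem_gradedPart_of_mem_cartan {H : LieSubalgebra K L} [H.IsCartanSubalgebra] (x : H)
    {i : ℤ} {h v : L} (hh : h ∈ H) (hv : v ∈ gradedPart K (x : L) i) :
    ⁅h, v⁆ ∈ gradedPart K (x : L) i := by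
  have : h ∈ gradedPart K (x : L) 0 := by
    rw [mem_gradedPart, lie_eq_zero_of_mem_cartan x.2 hh]
    simp
  simpa using lie_mem_gradedPart this hv

lemma mem_cartan_of_mem_rootSpace_zero {H : LieSubalgebra K L} [H.IsCartanSubalgebra]
    {χ : LieModule.Weight K H L} (hχ : χ.IsZero) {v : L} (hv : v ∈ rootSpace H χ) : v ∈ H := by
  rw [hχ.eq, rootSpace_zero_eq] at hv
  exact hv

lemma isGrading_of_forall_root {H : LieSubalgebra K L} [H.IsCartanSubalgebra] (x : H)
    (h : ∀ χ : LieModule.Weight K H L, χ.IsNonZero → ∃ i : ℤ, χ x = i) :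
    IsGrading K (x : L) := by
  rw [IsGrading, eq_top_iff]
  refine le_of_forall_weight H (by simp) fun χ v _ hv => ?_
  by_cases hχ : χ.IsZero
  · exact Submodule.mem_iSup_of_mem 0 (rootSpace_le_gradedPart (by simp [hχ.eq]) hv)
  · obtain ⟨i, hi⟩ := h χ hχ
    exact Submodule.mem_iSup_of_mem i (rootSpace_le_gradedPart hi hv)

lemma gradedPart_zero_eq {H : LieSubalgebra K L} [H.IsCartanSubalgebra] (x : H)
    (h : ∀ χ : LieModule.Weight K H L, χ.IsNonZero → χ x ≠ 0) :
    gradedPart K (x : L) 0 = H.toSubmodule := by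
  apply le_antisymm
  · refine le_of_forall_weight H (fun h hh v hv => lie_mem_gradedPart_of_mem_cartan x hh hv) ?_
    intro χ v hv hχ
    by_cases hv₀ : v = 0
    · simp [hv₀]
    by_cases hχ₀ : χ.IsZero
    · exact mem_cartan_of_mem_rootSpace_zero hχ₀ hχ
    · exact absurd (by simpa using apply_eq_of_mem_gradedPart hχ hv₀ hv) (h χ hχ₀)
  · intro v hv
    rw [mem_gradedPart, lie_eq_zero_of_mem_cartan x.2 hv]
    simp

lemma isRegularGrading_of_forall_root {H : LieSubalgebra K L} [H.IsCartanSubalgebra] (x : H)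
    (h : ∀ χ : LieModule.Weight K H L, χ.IsNonZero → ∃ i : ℤ, i ≠ 0 ∧ χ x = i) :
    IsRegularGrading K (x : L) where
  isGrading := isGrading_of_forall_root x fun χ hχ => (h χ hχ).imp fun _ h => h.2
  lie_eq_zero := by
    rw [gradedPart_zero_eq x fun χ hχ => ?_]
    · exact fun u hu v hv => lie_eq_zero_of_mem_cartan hu hv
    · obtain ⟨i, hi, hi'⟩ := h χ hχ
      rw [hi']
      exact_mod_cast hi

/-- Opposite Borel subalgebras inside weakly opposite subalgebras yield a Cartan subalgebra and a
compatible regular grading element. -/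
theorem exists_cartan_of_upper_one_inf_eq_bot {x x' : L} (hx : IsRegularGrading K x)
    (hx' : IsRegularGrading K x') (hbot : upper K x 1 ⊓ upper K x' 1 = ⊥) :
    ∃ (H : LieSubalgebra K L) (_ : H.IsCartanSubalgebra) (z : H),
      H.toSubmodule ≤ upper K x 0 ⊓ upper K x' 0 ∧
      ∀ α : LieModule.Weight K H L, α.IsNonZero → ∃ i : ℤ, i ≠ 0 ∧ α z = i ∧
        (0 < i → (rootSpace H α).toSubmodule ≤ upper K x 0) ∧
        (i < 0 → (rootSpace H α).toSubmodule ≤ upper K x' 0) := by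
  have hlie {w u v : L} (hw : IsRegularGrading K w) (hu : u ∈ upper K w 0)
      (hv : v ∈ upper K w 0) : ⁅u, v⁆ ∈ upper K w 1 := by
    have h₁ := lie_mem_upper hu hv
    have h₂ := hw.isGrading.proj_lie hu hv
    have h₃ := hw.isGrading.sub_proj_mem_upper h₁
    rw [h₂, hw.lie_eq_zero _ (hw.isGrading.proj_mem 0 u) _ (hw.isGrading.proj_mem 0 v),
      sub_zero, zero_add, zero_add] at h₃
    exact h₃
  have habel (u : L) (hu : u ∈ upper K x 0 ⊓ upper K x' 0) (v : L)
      (hv : v ∈ upper K x 0 ⊓ upper K x' 0) : ⁅u, v⁆ = 0 := by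
    have : ⁅u, v⁆ ∈ upper K x 1 ⊓ upper K x' 1 := ⟨hlie hx hu.1 hv.1, hlie hx' hu.2 hv.2⟩
    rwa [hbot] at this
  let H : LieSubalgebra K L :=
    { upper K x 0 ⊓ upper K x' 0 with
      lie_mem' := fun {u v} hu hv => by
        rw [habel u hu v hv]
        exact (upper K x 0 ⊓ upper K x' 0).zero_mem }
  obtain ⟨z, hz, n, hn, hzn⟩ : ∃ z ∈ upper K x 0 ⊓ upper K x' 0, ∃ n ∈ upper K x 1, z + n = x := by
    have := self_mem_upper (K := K) x
    rw [← IsRegularGrading.inf_sup_eq hx hx'] at this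
    exact Submodule.mem_sup.mp this
  have hz₀ : hx.isGrading.proj 0 z = x := by
    rw [eq_sub_of_add_eq hzn, map_sub, hx.isGrading.mem_upper_iff.mp hn 0 (by lia), sub_zero,
      hx.isGrading.proj_of_mem (self_mem_gradedPart x)]
  have hproj {i : ℤ} {v : L} (hv : v ∈ upper K x i) :
      ⁅z, v⁆ ∈ upper K x i ∧ hx.isGrading.proj i ⁅z, v⁆ = (i : K) • hx.isGrading.proj i v := by
    have h₁ := lie_mem_upper hz.1 hv
    have h₂ := hx.isGrading.proj_lie hz.1 hv
    rw [zero_add] at h₁ h₂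
    rw [hz₀, mem_gradedPart.mp (hx.isGrading.proj_mem i v)] at h₂
    exact ⟨h₁, h₂⟩
  -- `ad z` acts on lowest components by their degree, so a vector killed by its square starts in
  -- degree zero.
  have hlow {w : L} (hw : ⁅z, ⁅z, w⁆⁆ = 0) (hw₀ : w ≠ 0) :
      w ∈ upper K x 0 ∧ w ∉ upper K x 1 := by
    obtain ⟨i, hi, hi'⟩ := hx.isGrading.exists_lowest hw₀
    have h := (hproj (hproj hi).1).2
    rw [hw, map_zero, (hproj hi).2, smul_smul, eq_comm, smul_eq_zero] at h
    have hi₀ : i = 0 := by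
      have := h.resolve_right hi'
      rwa [mul_self_eq_zero, Int.cast_eq_zero] at this
    subst hi₀
    exact ⟨hi, fun h₁ => hi' (hx.isGrading.mem_upper_iff.mp h₁ 0 (by lia))⟩
  have hH' (w : L) (hw : ⁅z, ⁅z, w⁆⁆ = 0) : w ∈ H := by
    by_cases hw₀ : w = 0
    · rw [hw₀]; exact zero_mem _
    have h₁ := (hlow hw hw₀).1
    rw [← IsRegularGrading.inf_sup_eq hx hx'] at h₁
    -- The part `c` already commutes with `z`, so `m` is killed as well; starting in positive
    -- degree, it must vanish.
    obtain ⟨c, hc, m, hm, rfl⟩ := Submodule.mem_sup.mp h₁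
    have hm' : ⁅z, ⁅z, m⁆⁆ = 0 := by
      rwa [lie_add, habel z hz c hc, zero_add] at hw
    have hm₀ : m = 0 := by
      by_contra h
      exact (hlow hm' h).2 hm
    rw [hm₀, add_zero]
    exact hc
  have hH : H.IsCartanSubalgebra := isCartanSubalgebra_of_abelian H habel hz hH'
  have hroot {χ : H → K} {v : L} (hv : v ∈ rootSpace H χ) (hv₀ : v ≠ 0) :
      ∃ i : ℤ, χ ⟨z, hz⟩ = i ∧ v ∈ upper K x i := by
    obtain ⟨i, hi, hi'⟩ := hx.isGrading.exists_lowest hv₀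
    refine ⟨i, ?_, hi⟩
    have h₁ : ⁅z, v⁆ = χ ⟨z, hz⟩ • v := lie_eq_smul_of_mem_rootSpace hv ⟨z, hz⟩
    have h₂ := (hproj hi).2
    rw [h₁, map_smul] at h₂
    exact smul_left_injective K hi' h₂
  refine ⟨H, hH, ⟨z, hz⟩, le_rfl, fun α hα => ?_⟩
  obtain ⟨v, hv, hv₀⟩ := α.exists_ne_zero
  obtain ⟨i, hi, -⟩ := hroot hv hv₀
  refine ⟨i, ?_, hi, fun hpos u hu => ?_, fun hneg u hu => ?_⟩
  · rintro rfl
    have hzv : ⁅z, v⁆ = 0 := by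
      have h₁ : ⁅z, v⁆ = α ⟨z, hz⟩ • v := lie_eq_smul_of_mem_rootSpace hv ⟨z, hz⟩
      rw [h₁, hi]
      simp
    have hvH : v ∈ H := hH' v (by rw [hzv, lie_zero])
    refine hα (funext fun h => ?_)
    have h₁ := lie_eq_smul_of_mem_rootSpace hv h
    rw [LieSubalgebra.coe_bracket_of_module, lie_eq_zero_of_mem_cartan h.2 hvH, eq_comm,
      smul_eq_zero] at h₁
    exact h₁.resolve_right hv₀
  · by_cases hu₀ : u = 0
    · rw [hu₀]; exact zero_mem _
    obtain ⟨j, hj, hj'⟩ := hroot hu hu₀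
    have : i = j := by rw [hi] at hj; exact_mod_cast hj
    exact upper_mono x (by lia) hj'
  -- The second Borel is the orthogonal of its radical. Only weight `-α` can pair with `u`, and a
  -- vector of that weight in the radical has positive degree for `x`, so it lies in the trivial
  -- intersection of the two radicals.
  · have key : u ∈ upper K x' (1 - 1) := by
      refine hx'.isGrading.mem_upper_of_forall_killingForm ?_
      suffices upper K x' 1 ≤ LinearMap.ker (killingForm K L u) from fun w hw => this hw
      refine le_of_forall_weight H (fun h hh w hw => ?_) fun χ w hw hχ => ?_
      · have := lie_mem_upper hh.2 hw
        rwa [zero_add] at this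
      · rw [LinearMap.mem_ker]
        by_cases hw₀ : w = 0
        · simp [hw₀]
        by_cases hαχ : (α : H → K) + χ = 0
        · obtain ⟨j, hj, hj'⟩ := hroot hχ hw₀
          have hij : i + j = 0 := by
            have := congr_fun hαχ ⟨z, hz⟩
            rw [Pi.add_apply, Pi.zero_apply, hi, hj] at this
            exact_mod_cast this
          have : w ∈ upper K x 1 ⊓ upper K x' 1 := ⟨upper_mono x (by lia) hj', hw⟩
          rw [hbot] at this
          exact absurd this hw₀
        · exact killingForm_apply_eq_zero_of_mem_rootSpace_of_add_ne_zero K L H hu hχ hαχ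
    rwa [sub_self] at key

end CommonCartan

/-! ### Bases, rank, and weakly opposite parabolic subalgebras -/

section Parabolic

variable {K L : Type*} [Field K] [CharZero K] [IsAlgClosed K] [LieRing L] [LieAlgebra K L]
  [FiniteDimensional K L] [IsSemisimple K L]

lemma isNonZero_iff_mem_root {H : LieSubalgebra K L} [H.IsCartanSubalgebra]
    {χ : LieModule.Weight K H L} : χ.IsNonZero ↔ χ ∈ H.root := by
  simp [LieSubalgebra.root]

/-- Prescribing the values of the simple roots. -/
lemma exists_forall_support_apply_eq {H : LieSubalgebra K L} [H.IsCartanSubalgebra]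
    (B : (rootSystem H).Base) (c : H.root → K) :
    ∃ x : H, ∀ i ∈ B.support, (i : LieModule.Weight K H L) x = c i := by
  let φ : Dual K (Dual K H) := B.toWeightBasis.constr K fun i => c i
  refine ⟨(Module.evalEquiv K H).symm φ, fun i hi => ?_⟩
  have h₁ : φ (B.toWeightBasis ⟨i, hi⟩) = c i := by
    simp only [φ, Basis.constr_basis]
  have h₂ := Module.apply_evalEquiv_symm_apply (R := K) (M := H)
    (B.toWeightBasis ⟨i, hi⟩) φ
  rw [h₁, RootPairing.Base.toWeightBasis_apply, rootSystem_root_apply] at h₂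
  exact h₂

/-- Values on generators are natural numbers, so nothing cancels: a zero total only involves
generators of value zero. It is used with all values `1` for heights, and with values `0` and `1`
for Levi factors. -/
lemma exists_nat_apply_eq_of_mem_closure {H : LieSubalgebra K L} [H.IsCartanSubalgebra]
    {s : Set H.root} {x : H} {f : Dual K H} {c : H.root → ℕ}
    (hx : ∀ i ∈ s, (i : LieModule.Weight K H L) x = c i)
    (hf : f ∈ AddSubmonoid.closure ((rootSystem H).root '' s)) :
    ∃ n : ℕ, f x = n ∧
      (n = 0 → f ∈ AddSubmonoid.closure ((rootSystem H).root '' {i ∈ s | c i = 0})) := by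
  induction hf using AddSubmonoid.closure_induction with
  | zero => exact ⟨0, by simp, fun _ => zero_mem _⟩
  | mem f hf =>
    obtain ⟨i, hi, rfl⟩ := hf
    exact ⟨c i, hx i hi, fun h => AddSubmonoid.subset_closure ⟨i, ⟨hi, h⟩, rfl⟩⟩
  | add f g _ _ hf hg =>
    obtain ⟨m, hm, hm'⟩ := hf
    obtain ⟨n, hn, hn'⟩ := hg
    refine ⟨m + n, by simp [hm, hn], fun h => add_mem (hm' (by lia)) (hn' (by lia))⟩

/-- The element of a Cartan subalgebra on which all simple roots take the value one. -/
lemma exists_forall_root_height {H : LieSubalgebra K L} [H.IsCartanSubalgebra]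
    (B : (rootSystem H).Base) :
    ∃ x : H, ∀ α : H.root, ∃ n : ℕ, n ≠ 0 ∧
      ((α ∈ positiveRoots B ∧ (α : LieModule.Weight K H L) x = n) ∨
        (α : LieModule.Weight K H L) x = -n) := by
  obtain ⟨x, hx⟩ := exists_forall_support_apply_eq B fun _ => 1
  have key {f : Dual K H} (hf : f ∈ AddSubmonoid.closure ((rootSystem H).root '' B.support))
      (hf₀ : f ≠ 0) : ∃ n : ℕ, n ≠ 0 ∧ f x = n := by
    obtain ⟨n, hn, hn'⟩ := exists_nat_apply_eq_of_mem_closure (c := fun _ => 1)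
      (fun i hi => by simpa using hx i hi) hf
    refine ⟨n, fun h => hf₀ ?_, hn⟩
    simpa using hn' h
  refine ⟨x, fun α => ?_⟩
  have hα := (rootSystem H).ne_zero α
  rcases B.root_mem_or_neg_mem α with h | h
  · obtain ⟨n, hn, hn'⟩ := key h hα
    exact ⟨n, hn, Or.inl ⟨h, hn'⟩⟩
  · obtain ⟨n, hn, hn'⟩ := key h (neg_ne_zero.mpr hα)
    refine ⟨n, hn, Or.inr ?_⟩
    rw [← hn']
    simp

lemma exists_isRegularGrading_of_base {H : LieSubalgebra K L} [H.IsCartanSubalgebra]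
    (B : (rootSystem H).Base) :
    ∃ x : L, IsRegularGrading K x ∧ gradedPart K x 0 = H.toSubmodule ∧
      upper K x 0 ≤ cartanSum H (positiveRoots B) := by
  obtain ⟨x, hx⟩ := exists_forall_root_height B
  have hreg (χ : LieModule.Weight K H L) (hχ : χ.IsNonZero) : ∃ i : ℤ, i ≠ 0 ∧ χ x = i := by
    obtain ⟨n, hn, h⟩ := hx ⟨χ, isNonZero_iff_mem_root.mp hχ⟩
    rcases h with ⟨-, h⟩ | h
    · exact ⟨n, by exact_mod_cast hn, by simpa using h⟩
    · exact ⟨-n, by simpa using hn, by simpa using h⟩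
  refine ⟨x, isRegularGrading_of_forall_root x hreg, gradedPart_zero_eq x fun χ hχ => ?_, ?_⟩
  · obtain ⟨i, hi, hi'⟩ := hreg χ hχ
    rw [hi']
    exact_mod_cast hi
  · refine iSup₂_le fun i hi => le_of_forall_weight H
      (fun h hh v hv => lie_mem_gradedPart_of_mem_cartan x hh hv) fun χ v hv hχ => ?_
    by_cases hv₀ : v = 0
    · rw [hv₀]; exact zero_mem _
    by_cases hχ₀ : χ.IsZero
    · exact Submodule.mem_sup_left (mem_cartan_of_mem_rootSpace_zero hχ₀ hχ)
    · have hχi := apply_eq_of_mem_gradedPart hχ hv₀ hv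
      obtain ⟨n, hn, h⟩ := hx ⟨χ, isNonZero_iff_mem_root.mp hχ₀⟩
      rcases h with ⟨h, -⟩ | h
      · exact Submodule.mem_sup_right (Submodule.mem_iSup_of_mem _
          (Submodule.mem_iSup_of_mem h hχ))
      · exfalso
        have : (i : K) = ((-n : ℤ) : K) := by rw [← hχi]; simpa using h
        rw [Int.cast_inj] at this
        lia

/-- Each Cartan subalgebra is the centralizer of a regular grading element, and the dimension of
such a centralizer is fixed by comparing Borels. -/
lemma finrank_eq_of_isCartanSubalgebra (H H' : LieSubalgebra K L) [H.IsCartanSubalgebra]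
    [H'.IsCartanSubalgebra] : finrank K H = finrank K H' := by
  obtain ⟨B⟩ := (rootSystem H).nonempty_base
  obtain ⟨B'⟩ := (rootSystem H').nonempty_base
  obtain ⟨x, hx, h, -⟩ := exists_isRegularGrading_of_base B
  obtain ⟨x', hx', h', -⟩ := exists_isRegularGrading_of_base B'
  have := IsRegularGrading.finrank_gradedPart_zero_eq hx hx'
  rwa [h, h'] at this

/-- The Engel subalgebra of a regular element has least dimension, hence is minimal among Engel
subalgebras. Minimality puts it inside the Engel subalgebra of each of its elements, and Engel's
theorem makes it nilpotent. -/
lemma isCartanSubalgebra_engel_of_isRegular {x : L} (hx : IsRegular K x) :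
    (LieSubalgebra.engel K x).IsCartanSubalgebra := by
  refine ⟨?_, LieSubalgebra.normalizer_engel _ _⟩
  apply LieSubalgebra.isNilpotent_of_forall_le_engel
  intro y hy
  set E : {LieSubalgebra.engel K z | z ∈ LieSubalgebra.engel K x} :=
    ⟨LieSubalgebra.engel K x, x, LieSubalgebra.self_mem_engel _ _, rfl⟩
  suffices IsBot E from @this ⟨LieSubalgebra.engel K y, y, hy, rfl⟩
  have hcard : (finrank K L : Cardinal) ≤ Cardinal.mk K :=
    Cardinal.natCast_le_aleph0.trans (Cardinal.infinite_iff.mp inferInstance)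
  refine engel_isBot_of_isMin hcard (LieSubalgebra.engel K x) E le_rfl ?_
  rintro ⟨_, y, hy, rfl⟩ hyx
  suffices finrank K (LieSubalgebra.engel K x) ≤ finrank K (LieSubalgebra.engel K y) by
    suffices LieSubalgebra.engel K y = LieSubalgebra.engel K x from this.ge
    apply LieSubalgebra.toSubmodule_injective
    exact Submodule.eq_of_le_of_finrank_le hyx this
  rw [(isRegular_iff_finrank_engel_eq_rank K x).mp hx]
  apply rank_le_finrank_engel

/-- The rank is the common dimension of the Cartan subalgebras. -/
lemma finrank_cartan_eq_rank (H : LieSubalgebra K L) [H.IsCartanSubalgebra] :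
    finrank K H = LieAlgebra.rank K L := by
  obtain ⟨x, hx⟩ := LieAlgebra.exists_isRegular K L
  have := isCartanSubalgebra_engel_of_isRegular hx
  rw [finrank_eq_of_isCartanSubalgebra H (LieSubalgebra.engel K x)]
  exact (isRegular_iff_finrank_engel_eq_rank K x).mp hx

lemma IsParabolic.exists_isRegularGrading {p : LieSubalgebra K L} (hp : IsParabolic p) :
    ∃ x : L, IsRegularGrading K x ∧ upper K x 0 ≤ p.toSubmodule := by
  obtain ⟨b, ⟨H, hH, B, hb⟩, hbp⟩ := hp
  obtain ⟨x, hx, -, h⟩ := exists_isRegularGrading_of_base B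
  exact ⟨x, hx, h.trans (hb ▸ hbp)⟩

/-- Weakly opposite parabolic subalgebras contain opposite Borel subalgebras attached to a common
Cartan subalgebra. -/
theorem exists_common_cartan {p p' : LieSubalgebra K L} (hp : IsParabolic p)
    (hp' : IsParabolic p') (hpp' : WeaklyOpposite p p') :
    ∃ (H : LieSubalgebra K L) (_ : H.IsCartanSubalgebra) (z : H), H ≤ p ∧ H ≤ p' ∧
      ∀ α : LieModule.Weight K H L, α.IsNonZero → ∃ i : ℤ, i ≠ 0 ∧ α z = i ∧
        (0 < i → (rootSpace H α).toSubmodule ≤ p.toSubmodule) ∧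
        (i < 0 → (rootSpace H α).toSubmodule ≤ p'.toSubmodule) := by
  obtain ⟨x₀, hx₀, h₀⟩ := hp.exists_isRegularGrading
  obtain ⟨x₀', hx₀', h₀'⟩ := hp'.exists_isRegularGrading
  obtain ⟨x, x', hx, hx', hxp, hxp', hbot⟩ :=
    exists_upper_one_inf_eq_bot hx₀ hx₀' h₀ h₀' hpp'
  obtain ⟨H, hH, z, hHle, h⟩ := exists_cartan_of_upper_one_inf_eq_bot hx hx' hbot
  refine ⟨H, hH, z, (hHle.trans inf_le_left).trans hxp, (hHle.trans inf_le_right).trans hxp',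
    fun α hα => ?_⟩
  obtain ⟨i, hi, hi', h₁, h₂⟩ := h α hα
  exact ⟨i, hi, hi', fun h => (h₁ h).trans hxp, fun h => (h₂ h).trans hxp'⟩

end Parabolic

/-! ### The index of a Levi subalgebra is at least the rank -/

section Levi

variable {K L : Type*} [Field K] [CharZero K] [IsAlgClosed K] [LieRing L] [LieAlgebra K L]
  [FiniteDimensional K L] [IsSemisimple K L]

lemma engel_toSubmodule_eq_ker_pow (x : L) :
    (LieSubalgebra.engel K x).toSubmodule =
      LinearMap.ker (ad K L x ^ finrank K L : Module.End K L) := by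
  have h : (LieSubalgebra.engel K x).toSubmodule = (ad K L x).maxGenEigenspace 0 := rfl
  rw [h, Module.End.maxGenEigenspace_eq_genEigenspace_finrank, Module.End.genEigenspace_nat]
  simp

/-- Every centralizer has dimension at least the rank. -/
lemma rank_le_finrank_ker_ad (y : L) :
    LieAlgebra.rank K L ≤ finrank K (LinearMap.ker (ad K L y)) := by
  obtain ⟨z, hz⟩ := LieAlgebra.exists_isRegular K L
  -- The line joining `y` at `0` to the regular `z` at `1`. A generic point `w` on it is again
  -- regular, and its centralizer is no larger than that of `y`. The Engel subalgebra of `w` is a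
  -- Cartan subalgebra, hence commutative, so it centralizes `w`.
  let A : K → L →ₗ[K] L := fun s => ad K L y + (Polynomial.X : Polynomial K).eval s • ad K L (z - y)
  have hA : IsPolynomialFamily A :=
    (IsPolynomialFamily.const _).add ((IsPolynomialFamily.const _).eval_smul _)
  obtain ⟨s, hs⟩ := ((hA.finite_setOf_finrank_range_lt 0).union
    ((hA.pow (finrank K L)).finite_setOf_finrank_range_lt 1)).exists_notMem
  simp only [Set.mem_union, Set.mem_ofPred_eq, not_or, not_lt] at hs
  obtain ⟨hs₀, hs₁⟩ := hs
  obtain ⟨w, hw⟩ : ∃ w, A s = ad K L w := ⟨y + s • (z - y), by simp [A]⟩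
  have h₀ : finrank K (LinearMap.ker (ad K L w)) ≤ finrank K (LinearMap.ker (ad K L y)) := by
    have h₁ := LinearMap.finrank_range_add_finrank_ker (A s)
    have h₂ := LinearMap.finrank_range_add_finrank_ker (A 0)
    have h₃ : A 0 = ad K L y := by simp [A]
    rw [hw] at h₁ hs₀
    rw [h₃] at h₂ hs₀
    lia
  have hreg : IsRegular K w := by
    rw [isRegular_iff_finrank_engel_eq_rank] at hz ⊢
    refine le_antisymm ?_ (rank_le_finrank_engel K w)
    rw [← hz]
    have h₁ := LinearMap.finrank_range_add_finrank_ker (A s ^ finrank K L : Module.End K L)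
    have h₂ := LinearMap.finrank_range_add_finrank_ker (A 1 ^ finrank K L : Module.End K L)
    have h₃ : A 1 = ad K L z := by simp [A]
    rw [hw] at h₁ hs₁
    rw [h₃] at h₂ hs₁
    rw [← engel_toSubmodule_eq_ker_pow] at h₁ h₂
    change finrank K (LieSubalgebra.engel K w).toSubmodule ≤
      finrank K (LieSubalgebra.engel K z).toSubmodule
    lia
  have := isCartanSubalgebra_engel_of_isRegular hreg
  rw [← (isRegular_iff_finrank_engel_eq_rank K w).mp hreg]
  refine le_trans (Submodule.finrank_mono (s := (LieSubalgebra.engel K w).toSubmodule) ?_) h₀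
  intro v hv
  exact lie_eq_zero_of_mem_cartan (LieSubalgebra.self_mem_engel K w) hv

lemma IsGrading.proj_lie_of_mem {x u : L} (hx : IsGrading K x) (hu : u ∈ gradedPart K x 0)
    (i : ℤ) (v : L) : hx.proj i ⁅u, v⁆ = ⁅u, hx.proj i v⁆ := by
  induction v using hx.induction with
  | h₀ => simp
  | hadd _ _ h₁ h₂ => simp [h₁, h₂]
  | h j v hv =>
    have h := lie_mem_gradedPart hu hv
    rw [zero_add] at h
    by_cases hj : j = i
    · subst hj
      rw [hx.proj_of_mem h, hx.proj_of_mem hv]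
    · rw [hx.proj_of_mem_of_ne h hj, hx.proj_of_mem_of_ne hv hj, lie_zero]

/-- Centralizers in the centralizer of a grading element have dimension at least the rank. -/
lemma IsGrading.rank_le_finrank_inf_ker_ad {z u : L} (hz : IsGrading K z)
    (hu : u ∈ gradedPart K z 0) :
    LieAlgebra.rank K L ≤ finrank K ↥(gradedPart K z 0 ⊓ LinearMap.ker (ad K L u)) := by
  obtain ⟨N, hN⟩ := IsGrading.exists_bound (K := K) z
  -- A vector of degree `i ≠ 0` commutes with `u + t • z` only if `-t * i` is an eigenvalue of `ad
  -- u`. Avoiding these `t` forces the centralizer into degree zero; the pairs with `i = 0` merely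
  -- exclude the value `0` as well.
  have hfin : ((fun w : ℤ × K => -w.2 / w.1) ''
      ((Set.Icc (-N : ℤ) N) ×ˢ {μ | (ad K L u).HasEigenvalue μ})).Finite :=
    ((Set.finite_Icc _ _).prod (Module.End.finite_hasEigenvalue (ad K L u))).image _
  obtain ⟨t, ht⟩ := hfin.exists_notMem
  refine (rank_le_finrank_ker_ad (u + t • z)).trans (Submodule.finrank_mono fun v hv => ?_)
  rw [LinearMap.mem_ker, ad_apply, add_lie, smul_lie] at hv
  have hv' (i : ℤ) : ⁅u, hz.proj i v⁆ = (-(t * i)) • hz.proj i v := by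
    have := congr(hz.proj i $hv)
    rw [map_add, map_smul, hz.proj_self_lie, hz.proj_lie_of_mem hu, map_zero,
      add_eq_zero_iff_eq_neg, smul_smul, ← neg_smul] at this
    exact this
  have h₀ (i : ℤ) (hi : i ≠ 0) : hz.proj i v = 0 := by
    by_contra h
    refine ht ⟨(i, -(t * i)), ⟨?_, ?_⟩, ?_⟩
    · rw [Set.mem_Icc, ← abs_le]
      by_contra hiN
      have := hz.proj_mem i v
      rw [hN i (not_le.mp hiN)] at this
      exact h this
    · exact Module.End.hasEigenvalue_of_hasEigenvector
        ⟨Module.End.mem_eigenspace_iff.mpr (hv' i), h⟩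
    · have : (i : K) ≠ 0 := by exact_mod_cast hi
      simp [this]
  have hvz : ⁅z, v⁆ = 0 := hz.eq_zero_of_forall_proj fun i => by
    rw [hz.proj_self_lie]
    by_cases hi : i = 0
    · simp [hi]
    · rw [h₀ i hi, smul_zero]
  refine ⟨mem_gradedPart.mpr (by simp [hvz]), ?_⟩
  rw [hvz, smul_zero, add_zero] at hv
  exact hv

/-- The Killing form represents any form on the degree-zero part by an element `w` of that part, and
by invariance the centralizer of `w` in `q` lies in the kernel of the bracket form. -/
lemma rank_le_index_of_eq_gradedPart {q : LieSubalgebra K L} {z : L} (hz : IsGrading K z)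
    (hq : q.toSubmodule = gradedPart K z 0) : LieAlgebra.rank K L ≤ index K q := by
  refine le_ciInf fun f => ?_
  obtain ⟨F, hF⟩ := LinearMap.exists_extend (p := q.toSubmodule) f
  obtain ⟨w, hw⟩ : ∃ w, killingForm K L w = F :=
    ⟨((killingForm K L).toDual (killingForm_nondegenerate K L)).symm F,
      ((killingForm K L).toDual (killingForm_nondegenerate K L)).apply_symm_apply F⟩
  have hf (v : q) : f v = killingForm K L (hz.proj 0 w) v := by
    rw [hz.killingForm_proj, neg_zero, hz.proj_of_mem (hq ▸ v.2), hw]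
    exact (LinearMap.congr_fun hF v).symm
  refine (hz.rank_le_finrank_inf_ker_ad (hz.proj_mem 0 w)).trans ?_
  rw [← hq, ← Submodule.map_comap_subtype, Submodule.finrank_map_subtype_eq]
  refine Submodule.finrank_mono fun (u : q) hu => ?_
  rw [LinearMap.mem_ker]
  ext v
  change f ⁅u, v⁆ = 0
  have hu' : ⁅hz.proj 0 w, (u : L)⁆ = 0 := by simpa using hu
  rw [hf, LieSubalgebra.coe_bracket, ← LieModule.traceForm_apply_lie_apply, hu']
  simp

/-- Take `z` in the Cartan subalgebra with value `0` on the simple roots in `S` and `1` on the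
others. -/
lemma IsLevi.exists_isGrading {q : LieSubalgebra K L} (hq : IsLevi q) :
    ∃ z : L, IsGrading K z ∧ q.toSubmodule = gradedPart K z 0 := by
  classical
  obtain ⟨H, hH, B, S, hS, hq⟩ := hq
  let c : H.root → ℕ := fun i => if i ∈ S then 0 else 1
  obtain ⟨x, hx⟩ := exists_forall_support_apply_eq B fun i => (c i : K)
  have hcS : {i ∈ (B.support : Set H.root) | c i = 0} ⊆ S := fun i hi => by
    by_contra h
    simp [c, h] at hi
  have hmono {f : Dual K H}
      (hf : f ∈ AddSubmonoid.closure ((rootSystem H).root '' {i ∈ (B.support : Set H.root) | c i = 0})) :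
      f ∈ AddSubgroup.closure ((rootSystem H).root '' S) :=
    AddSubgroup.closure_mono (Set.image_mono hcS) (AddSubgroup.le_closure_toAddSubmonoid _ hf)
  have key (α : H.root) : ∃ i : ℤ, (α : LieModule.Weight K H L) x = i ∧
      (i = 0 → α ∈ rootsSpannedBy S) := by
    rcases B.root_mem_or_neg_mem α with h | h
    · obtain ⟨n, hn, hn'⟩ := exists_nat_apply_eq_of_mem_closure hx h
      exact ⟨n, by simpa using hn, fun h₀ => hmono (hn' (by exact_mod_cast h₀))⟩
    · obtain ⟨n, hn, hn'⟩ := exists_nat_apply_eq_of_mem_closure hx h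
      refine ⟨-n, ?_, fun h₀ => ?_⟩
      · rw [Int.cast_neg, Int.cast_natCast, ← hn]
        simp
      · exact neg_mem_iff.mp (hmono (hn' (by simpa using h₀)))
  refine ⟨x, isGrading_of_forall_root x fun χ hχ => ?_, ?_⟩
  · obtain ⟨i, hi, -⟩ := key ⟨χ, isNonZero_iff_mem_root.mp hχ⟩
    exact ⟨i, hi⟩
  rw [hq]
  apply le_antisymm
  · refine sup_le (fun v hv => ?_) (iSup₂_le fun α hα => ?_)
    · rw [mem_gradedPart, lie_eq_zero_of_mem_cartan x.2 hv]
      simp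
    · refine rootSpace_le_gradedPart ?_
      have : ∀ f ∈ AddSubgroup.closure ((rootSystem H).root '' S), f x = 0 := by
        intro f hf
        induction hf using AddSubgroup.closure_induction with
        | zero => simp
        | mem f hf =>
          obtain ⟨i, hi, rfl⟩ := hf
          have := hx i (hS hi)
          simpa [c, hi] using this
        | add f g _ _ hf hg => simp [hf, hg]
        | neg f _ hf => simp [hf]
      simpa using this _ hα
  · refine le_of_forall_weight H
      (fun h hh v hv => lie_mem_gradedPart_of_mem_cartan x hh hv) fun χ v hv hχ => ?_
    by_cases hv₀ : v = 0
    · rw [hv₀]; exact zero_mem _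
    by_cases hχ₀ : χ.IsZero
    · exact Submodule.mem_sup_left (mem_cartan_of_mem_rootSpace_zero hχ₀ hχ)
    · have hχi := apply_eq_of_mem_gradedPart hχ hv₀ hv
      obtain ⟨i, hi, h⟩ := key ⟨χ, isNonZero_iff_mem_root.mp hχ₀⟩
      have hi₀ : i = 0 := by
        have : (i : K) = ((0 : ℤ) : K) := by rw [← hi, ← hχi]
        exact_mod_cast this
      exact Submodule.mem_sup_right (Submodule.mem_iSup_of_mem _
        (Submodule.mem_iSup_of_mem (h hi₀) hχ))

/-- The index of a Levi subalgebra is at least the rank. -/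
theorem IsLevi.rank_le_index {q : LieSubalgebra K L} (hq : IsLevi q) :
    LieAlgebra.rank K L ≤ index K q := by
  obtain ⟨z, hz, hq⟩ := hq.exists_isGrading
  exact rank_le_index_of_eq_gradedPart hz hq

end Levi

/-! ### Kostant's cascade and a nondegenerate linear form -/

section Cascade

variable {K L : Type*} [Field K] [CharZero K] [IsAlgClosed K] [LieRing L] [LieAlgebra K L]
  [FiniteDimensional K L] [IsKilling K L]
  {H : LieSubalgebra K L} [H.IsCartanSubalgebra]

/-- The sum of the root spaces attached to a finite set of weights. -/
def weightSum (N : Finset (LieModule.Weight K H L)) : Submodule K L :=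
  ⨆ α ∈ N, (rootSpace H α).toSubmodule

lemma rootSpace_le_weightSum {N : Finset (LieModule.Weight K H L)} {α : LieModule.Weight K H L}
    (hα : α ∈ N) : (rootSpace H α).toSubmodule ≤ weightSum N :=
  le_iSup₂_of_le α hα le_rfl

lemma exists_eq_sum_of_mem_weightSum {N : Finset (LieModule.Weight K H L)} {y : L}
    (hy : y ∈ weightSum N) :
    ∃ c : LieModule.Weight K H L → L, (∀ α : LieModule.Weight K H L, c α ∈ rootSpace H α) ∧
      y = ∑ α ∈ N, c α := by
  obtain ⟨μ, hμ⟩ := (Submodule.mem_iSup_finset_iff_exists_sum _ _).mp hy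
  exact ⟨fun α => μ α, fun α => (μ α).2, hμ.symm⟩

lemma exists_weight_of_ne_zero {χ : H → K} {v : L} (hv : v ∈ rootSpace H χ) (hv₀ : v ≠ 0) :
    ∃ γ : LieModule.Weight K H L, (γ : H → K) = χ :=
  ⟨⟨χ, fun h => hv₀ (by
    have hv' : v ∈ LieModule.genWeightSpace L χ := hv
    rw [h] at hv'
    exact hv')⟩, rfl⟩

lemma lie_mem_rootSpace_add {χ₁ χ₂ : H → K} {u v : L} (hu : u ∈ rootSpace H χ₁)
    (hv : v ∈ rootSpace H χ₂) : ⁅u, v⁆ ∈ rootSpace H (χ₁ + χ₂) :=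
  LieAlgebra.lie_mem_genWeightSpace_of_mem_genWeightSpace hu hv

lemma exists_nat_of_lie_eq_zero {ε : LieModule.Weight K H L} (hε : ε.IsNonZero) {h e f v : L}
    (ht : IsSl2Triple h e f) (he : e ∈ rootSpace H ε) (hf : f ∈ rootSpace H (-ε))
    {χ : H → K} (hv : v ∈ rootSpace H χ) (hv₀ : v ≠ 0) (hev : ⁅e, v⁆ = 0) :
    ∃ n : ℕ, χ (coroot ε) = n := by
  have P : ht.HasPrimitiveVectorWith v (χ (coroot ε)) :=
    { ne_zero := hv₀
      lie_h := by
        rw [ht.h_eq_coroot hε he hf]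
        exact lie_eq_smul_of_mem_rootSpace hv (coroot ε)
      lie_e := hev }
  exact P.exists_nat

lemma exists_nat_of_lie_eq_zero' {ε : LieModule.Weight K H L} (hε : ε.IsNonZero) {h e f v : L}
    (ht : IsSl2Triple h e f) (he : e ∈ rootSpace H ε) (hf : f ∈ rootSpace H (-ε))
    {χ : H → K} (hv : v ∈ rootSpace H χ) (hv₀ : v ≠ 0) (hfv : ⁅f, v⁆ = 0) :
    ∃ n : ℕ, -χ (coroot ε) = n := by
  have P : ht.symm.HasPrimitiveVectorWith v (-χ (coroot ε)) :=
    { ne_zero := hv₀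
      lie_h := by
        rw [ht.h_eq_coroot hε he hf, neg_lie, neg_smul]
        exact congr(-$(lie_eq_smul_of_mem_rootSpace hv (coroot ε)))
      lie_e := hfv }
  exact P.exists_nat

lemma exists_killingForm_ne_zero {χ : H → K} {v : L} (hv : v ∈ rootSpace H χ) (hv₀ : v ≠ 0) :
    ∃ x ∈ rootSpace H (-χ), killingForm K L v x ≠ 0 := by
  contrapose! hv₀
  simpa using mem_ker_killingForm_of_mem_rootSpace_of_forall_rootSpace_neg K L H hv hv₀

lemma apply_coroot_eq_zero_comm {α β : LieModule.Weight K H L} (hα : α.IsNonZero)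
    (hβ : β.IsNonZero) (h : α (coroot β) = 0) : β (coroot α) = 0 := by
  have := (rootSystem H).pairing_eq_zero_iff (i := ⟨α, by simpa using hα⟩)
    (j := ⟨β, by simpa using hβ⟩)
  simp only [rootSystem_pairing_apply] at this
  exact this.mp h

/-- A set of weights, positive for some height function, which is closed under addition and under
positive differences. -/
structure IsClosedPositive (ht : LieModule.Weight K H L → ℤ)
    (N : Finset (LieModule.Weight K H L)) : Prop where
  pos : ∀ α ∈ N, 0 < ht α
  add : ∀ α ∈ N, ∀ β ∈ N, ∀ γ : LieModule.Weight K H L, (γ : H → K) = α + β → γ ∈ N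
  sub : ∀ α ∈ N, ∀ β ∈ N, ∀ γ : LieModule.Weight K H L, (γ : H → K) = α - β → 0 < ht γ → γ ∈ N

/-- A height function on weights given by the values at an element of the Cartan subalgebra. -/
structure IsHeight (z : H) (ht : LieModule.Weight K H L → ℤ) : Prop where
  apply_eq : ∀ χ : LieModule.Weight K H L, χ z = ht χ
  ne_zero : ∀ χ : LieModule.Weight K H L, χ.IsNonZero → ht χ ≠ 0

namespace IsHeight

variable {z : H} {ht : LieModule.Weight K H L → ℤ}

lemma isNonZero (h : IsHeight z ht) {χ : LieModule.Weight K H L} (hχ : ht χ ≠ 0) :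
    χ.IsNonZero := fun h₀ => hχ (by
  have := h.apply_eq χ
  rw [h₀.eq] at this
  simpa using this.symm)

lemma eq_add (h : IsHeight z ht) {α β γ : LieModule.Weight K H L} (hγ : (γ : H → K) = α + β) :
    ht γ = ht α + ht β := by
  have := congr_fun hγ z
  rw [Pi.add_apply, h.apply_eq, h.apply_eq, h.apply_eq] at this
  exact_mod_cast this

lemma eq_sub (h : IsHeight z ht) {α β γ : LieModule.Weight K H L} (hγ : (γ : H → K) = α - β) :
    ht γ = ht α - ht β := by
  have := congr_fun hγ z
  rw [Pi.sub_apply, h.apply_eq, h.apply_eq, h.apply_eq] at this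
  exact_mod_cast this

end IsHeight

namespace IsClosedPositive

variable {z : H} {ht : LieModule.Weight K H L → ℤ} {N : Finset (LieModule.Weight K H L)}
  {ε : LieModule.Weight K H L}

lemma filter_orthogonal (hN : IsClosedPositive ht N) (ε : LieModule.Weight K H L)
    [DecidablePred fun α : LieModule.Weight K H L => α (coroot ε) = 0] :
    IsClosedPositive ht (N.filter fun α => α (coroot ε) = 0) where
  pos α hα := hN.pos α (Finset.mem_filter.mp hα).1
  add α hα β hβ γ hγ := by
    rw [Finset.mem_filter] at *
    exact ⟨hN.add α hα.1 β hβ.1 γ hγ, by rw [hγ, Pi.add_apply, hα.2, hβ.2, add_zero]⟩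
  sub α hα β hβ γ hγ hpos := by
    rw [Finset.mem_filter] at *
    exact ⟨hN.sub α hα.1 β hβ.1 γ hγ hpos, by rw [hγ, Pi.sub_apply, hα.2, hβ.2, sub_zero]⟩

lemma not_eq_add_of_max (hN : IsClosedPositive ht N) (hz : IsHeight z ht) (hε : ε ∈ N)
    (hmax : ∀ α ∈ N, ht α ≤ ht ε) {α γ : LieModule.Weight K H L} (hα : α ∈ N) :
    (γ : H → K) ≠ ε + α := fun h => by
  have h₁ := hmax γ (hN.add ε hε α hα γ h)
  have h₂ := hz.eq_add h
  have h₃ := hN.pos α hα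
  lia

/-- As `ε + α` is not a weight, vectors of weight `α` are highest weight vectors for the `sl₂` of
`ε`. -/
lemma exists_nat_apply_coroot (hN : IsClosedPositive ht N) (hz : IsHeight z ht) (hε : ε ∈ N)
    (hmax : ∀ α ∈ N, ht α ≤ ht ε) {α : LieModule.Weight K H L} (hα : α ∈ N) :
    ∃ n : ℕ, α (coroot ε) = n := by
  have hε₀ : ε.IsNonZero := hz.isNonZero (hN.pos ε hε).ne'
  obtain ⟨h, e, f, t, he, hf⟩ := exists_isSl2Triple_of_weight_isNonZero hε₀
  obtain ⟨v, hv, hv₀⟩ := α.exists_ne_zero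
  refine exists_nat_of_lie_eq_zero hε₀ t he hf hv hv₀ ?_
  by_contra hev
  obtain ⟨γ, hγ⟩ := exists_weight_of_ne_zero (lie_mem_rootSpace_add he hv) hev
  exact hN.not_eq_add_of_max hz hε hmax hα hγ

/-- A root of maximal height pairs a root not orthogonal to it with the complementary root. -/
lemma sub_mem_of_max (hN : IsClosedPositive ht N) (hz : IsHeight z ht) (hε : ε ∈ N)
    (hmax : ∀ α ∈ N, ht α ≤ ht ε) {α δ : LieModule.Weight K H L} (hα : α ∈ N)
    (hα₀ : α (coroot ε) ≠ 0) (hαε : α ≠ ε) (hδ : (δ : H → K) = ε - α) :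
    δ ∈ N ∧ δ (coroot ε) = 1 := by
  have hε₀ : ε.IsNonZero := hz.isNonZero (hN.pos ε hε).ne'
  have hδ₀ : δ.IsNonZero := fun h => hαε (by
    rw [h.eq, eq_comm, sub_eq_zero] at hδ
    exact DFunLike.coe_injective hδ.symm)
  have hpos : 0 < ht δ := by
    have h₁ := hz.eq_sub hδ
    have h₂ := hmax α hα
    have h₃ := hz.ne_zero δ hδ₀
    lia
  have hδN := hN.sub ε hε α hα δ hδ hpos
  refine ⟨hδN, ?_⟩
  obtain ⟨n, hn⟩ := hN.exists_nat_apply_coroot hz hε hmax hα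
  obtain ⟨m, hm⟩ := hN.exists_nat_apply_coroot hz hε hmax hδN
  have hsum : m + n = 2 := by
    have := congr_fun hδ (coroot ε)
    rw [Pi.sub_apply, hm, hn, root_apply_coroot hε₀, eq_sub_iff_add_eq] at this
    exact_mod_cast this
  have hn₀ : n ≠ 0 := by
    rintro rfl
    exact hα₀ (by simpa using hn)
  -- If `n = 2`, reflecting `α` in `ε` and changing sign gives the root `2ε - α = ε + δ`, which is
  -- impossible by maximality.
  have hn₂ : n ≠ 2 := by
    rintro rfl
    refine hN.not_eq_add_of_max hz hε hmax hδN (γ := -reflectRoot ε α) ?_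
    rw [LieModule.Weight.coe_neg]
    change -((α : H → K) - α (coroot ε) • (ε : H → K)) = _
    rw [hn, hδ]
    ext h
    simp
    ring
  rw [hm, show m = 1 by lia, Nat.cast_one]

/-- The bracket with a vector of weight `δ` sees only one component under a linear form concentrated
in a single weight. -/
lemma killingForm_lie_eq_zero {χ δ β : H → K} {f x y : L} (hf : f ∈ rootSpace H χ)
    (hx : x ∈ rootSpace H δ) (hy : y ∈ rootSpace H β) (h : χ + (δ + β) ≠ 0) :
    killingForm K L f ⁅x, y⁆ = 0 :=
  killingForm_apply_eq_zero_of_mem_rootSpace_of_add_ne_zero K L H hf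
    (lie_mem_rootSpace_add hx hy) h

section Step

variable {F : Dual K L} {c : LieModule.Weight K H L → L} {h e f : L}

/-- The components of an isotropic vector at the weights which are not orthogonal to the root of
maximal height vanish. -/
lemma component_eq_zero (hN : IsClosedPositive ht N) (hz : IsHeight z ht) (hε : ε ∈ N)
    (hmax : ∀ α ∈ N, ht α ≤ ht ε) (t : IsSl2Triple h e f) (he : e ∈ rootSpace H ε)
    (hf : f ∈ rootSpace H (-ε))
    (hF : ∀ χ : H → K, χ (coroot ε) ≠ 0 → ∀ v ∈ rootSpace H χ, F v = 0)
    (hc : ∀ α : LieModule.Weight K H L, c α ∈ rootSpace H α)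
    (hy : ∀ x ∈ weightSum N, killingForm K L f ⁅x, ∑ β ∈ N, c β⁆ + F ⁅x, ∑ β ∈ N, c β⁆ = 0)
    {α : LieModule.Weight K H L} (hα : α ∈ N) (hα₀ : α (coroot ε) ≠ 0) (hαε : α ≠ ε) :
    c α = 0 := by
  have hε₀ : ε.IsNonZero := hz.isNonZero (hN.pos ε hε).ne'
  by_contra hcα
  have hfc : ⁅f, c α⁆ ≠ 0 := fun hfc => by
    obtain ⟨n, hn⟩ := hN.exists_nat_apply_coroot hz hε hmax hα
    obtain ⟨m, hm⟩ := exists_nat_of_lie_eq_zero' hε₀ t he hf (hc α) hcα hfc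
    rw [hn, neg_eq_iff_add_eq_zero] at hm
    have hmn : n + m = 0 := by exact_mod_cast hm
    exact hα₀ (by rw [hn, show n = 0 by lia, Nat.cast_zero])
  -- Testing against `x` of weight `ε - α` isolates `c α`: under `f` only the total weight `ε`
  -- survives, and `F` sees nothing since `δ + β` pairs positively with the coroot of `ε`.
  obtain ⟨x, hx, hκ⟩ := exists_killingForm_ne_zero (lie_mem_rootSpace_add hf (hc α)) hfc
  have hx₀ : x ≠ 0 := by
    rintro rfl
    simp at hκ
  obtain ⟨δ, hδ⟩ := exists_weight_of_ne_zero hx hx₀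
  rw [← hδ] at hx
  have hδ' : (δ : H → K) = ε - α := by rw [hδ]; abel
  obtain ⟨hδN, hδ₁⟩ := hN.sub_mem_of_max hz hε hmax hα hα₀ hαε hδ'
  have h₁ : F ⁅x, ∑ β ∈ N, c β⁆ = 0 := by
    rw [lie_sum, map_sum]
    refine Finset.sum_eq_zero fun β hβ => hF (δ + β) ?_ _ (lie_mem_rootSpace_add hx (hc β))
    obtain ⟨n, hn⟩ := hN.exists_nat_apply_coroot hz hε hmax hβ
    rw [Pi.add_apply, hδ₁, hn, add_comm]
    exact Nat.cast_add_one_ne_zero n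
  have h₂ : killingForm K L f ⁅x, ∑ β ∈ N, c β⁆ = killingForm K L f ⁅x, c α⁆ := by
    rw [lie_sum, map_sum, Finset.sum_eq_single_of_mem α hα]
    intro β _ hβα
    refine killingForm_lie_eq_zero hf hx (hc β) fun h₀ => hβα (DFunLike.coe_injective ?_)
    rw [hδ'] at h₀
    have : (β : H → K) - α = 0 := by rw [← h₀]; abel
    exact sub_eq_zero.mp this
  have h₃ := hy x (rootSpace_le_weightSum hδN hx)
  rw [h₁, h₂, add_zero, ← lie_skew, map_neg, neg_eq_zero,
    ← LieModule.traceForm_apply_lie_apply] at h₃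
  exact hκ h₃

end Step

/-- On the sum of the root spaces of a closed set of positive roots there is a linear form whose
isotropy, even relative to the coroots, is trivial. -/
theorem exists_dual (hz : IsHeight z ht) (hN : IsClosedPositive ht N) :
    ∃ F : Dual K L, (∀ χ : H → K, (∀ γ ∈ N, (γ : H → K) ≠ χ) → ∀ v ∈ rootSpace H χ, F v = 0) ∧
      ∀ y ∈ weightSum N, (∀ x ∈ weightSum N, F ⁅x, y⁆ = 0) →
        (∀ α ∈ N, F ⁅(coroot α : L), y⁆ = 0) → y = 0 := by
  classical
  induction N using Finset.strongInduction with
  | H N ih =>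
  rcases N.eq_empty_or_nonempty with rfl | hne
  · exact ⟨0, by simp, fun y hy _ _ => by simpa [weightSum] using hy⟩
  obtain ⟨ε, hε, hmax⟩ := N.exists_max_image ht hne
  have hε₀ : ε.IsNonZero := hz.isNonZero (hN.pos ε hε).ne'
  have hε₂ : ε (coroot ε) = 2 := root_apply_coroot hε₀
  obtain ⟨h, e, f, t, he, hf⟩ := exists_isSl2Triple_of_weight_isNonZero hε₀
  -- The cascade continues with the roots orthogonal to `ε`. The form sought is `κ(f, ·)`, dual to
  -- weight `ε`, plus the form obtained for these roots.
  set N' := N.filter fun α => α (coroot ε) = 0 with hN'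
  have hεN' : ε ∉ N' := by simp [hN', hε₂]
  obtain ⟨F, hF, hF'⟩ := ih N' (Finset.filter_ssubset.mpr ⟨ε, hε, by simp [hε₂]⟩)
    (hN.filter_orthogonal ε)
  have hFN' (χ : H → K) (hχ : χ (coroot ε) ≠ 0) (v : L) (hv : v ∈ rootSpace H χ) : F v = 0 := by
    refine hF χ (fun γ hγ h₀ => hχ ?_) v hv
    rw [← h₀]
    exact (Finset.mem_filter.mp hγ).2
  have hκ (χ : H → K) (hχ : (ε : H → K) ≠ χ) (v : L) (hv : v ∈ rootSpace H χ) :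
      killingForm K L f v = 0 :=
    killingForm_apply_eq_zero_of_mem_rootSpace_of_add_ne_zero K L H hf hv fun h₀ =>
      hχ (neg_add_eq_zero.mp h₀)
  refine ⟨killingForm K L f + F, fun χ hχ v hv => ?_, fun y hy hyx hyα => ?_⟩
  · rw [LinearMap.add_apply, hκ χ (hχ ε hε) v hv,
      hF χ (fun γ hγ => hχ γ (Finset.mem_filter.mp hγ).1) v hv, add_zero]
  obtain ⟨c, hc, rfl⟩ := exists_eq_sum_of_mem_weightSum hy
  simp only [LinearMap.add_apply] at hyx hyα
  have hy' : ∑ β ∈ N, c β = c ε + ∑ β ∈ N', c β := by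
    rw [← Finset.sum_insert hεN']
    refine (Finset.sum_subset ?_ fun α hα hα' => ?_).symm
    · exact Finset.insert_subset hε (Finset.filter_subset _ _)
    · rw [Finset.mem_insert, not_or, hN', Finset.mem_filter, not_and] at hα'
      exact component_eq_zero hN hz hε hmax t he hf hFN' hc hyx hα (hα'.2 hα) hα'.1
  have hmem : ∑ β ∈ N', c β ∈ weightSum N' :=
    sum_mem fun β hβ => rootSpace_le_weightSum hβ (hc β)
  rw [hy'] at hyx hyα ⊢
  have hzero : ∑ β ∈ N', c β = 0 := by
    refine hF' _ hmem (fun x hx => ?_) fun α hα => ?_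
    · suffices weightSum N' ≤ LinearMap.ker (F ∘ₗ (ad K L (∑ β ∈ N', c β))) by
        have := this hx
        rw [LinearMap.mem_ker, LinearMap.comp_apply, ad_apply, ← lie_skew, map_neg,
          neg_eq_zero] at this
        exact this
      refine iSup₂_le fun γ hγ x hx => ?_
      have hγ' := Finset.mem_filter.mp hγ
      rw [LinearMap.mem_ker, LinearMap.comp_apply, ad_apply, ← lie_skew, map_neg, neg_eq_zero]
      have h₁ := hyx x (rootSpace_le_weightSum hγ'.1 hx)
      have h₂ : killingForm K L f ⁅x, c ε⁆ = 0 := by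
        refine killingForm_lie_eq_zero hf hx (hc ε) fun h₀ => ?_
        refine hz.isNonZero (hN.pos γ hγ'.1).ne' ?_
        change (γ : H → K) = 0
        rw [← h₀]
        abel
      have h₃ : killingForm K L f ⁅x, ∑ β ∈ N', c β⁆ = 0 := by
        rw [lie_sum, map_sum]
        refine Finset.sum_eq_zero fun β hβ => killingForm_lie_eq_zero hf hx (hc β) fun h₀ => ?_
        have := congr_fun h₀ (coroot ε)
        simp [hε₂, hγ'.2, (Finset.mem_filter.mp hβ).2] at this
      have h₄ : F ⁅x, c ε⁆ = 0 :=
        hFN' _ (by simp [hε₂, hγ'.2]) _ (lie_mem_rootSpace_add hx (hc ε))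
      rwa [lie_add, map_add, map_add, h₂, h₃, h₄, zero_add, zero_add, zero_add] at h₁
    -- Coroots of `N'` kill `c ε`, so the contribution of `ε` drops out; this is where testing on
    -- coroots, rather than on the whole Cartan subalgebra, is used.
    · have hα' := Finset.mem_filter.mp hα
      have h₁ := hyα α hα'.1
      have h₂ : ⁅(coroot α : L), c ε⁆ = 0 := by
        have := lie_eq_smul_of_mem_rootSpace (hc ε) (coroot α)
        rw [apply_coroot_eq_zero_comm (hz.isNonZero (hN.pos α hα'.1).ne') hε₀ hα'.2,
          zero_smul] at this
        exact this
      have h₃ : killingForm K L f ⁅(coroot α : L), ∑ β ∈ N', c β⁆ = 0 := by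
        rw [lie_sum, map_sum]
        refine Finset.sum_eq_zero fun β hβ => ?_
        have : ⁅(coroot α : L), c β⁆ = β (coroot α) • c β :=
          lie_eq_smul_of_mem_rootSpace (hc β) (coroot α)
        rw [this, map_smul, hκ β _ _ (hc β), smul_zero]
        intro h₀
        exact hεN' (DFunLike.coe_injective h₀ ▸ hβ)
      rwa [lie_add, h₂, zero_add, h₃, zero_add] at h₁
  rw [hzero, add_zero]
  -- Only `c ε` is left. The coroot of `ε` scales it by `2`, so `κ(f, c ε) = 0` and hence `⁅f, c ε⁆
  -- = 0`; then `-2` would have to be a natural number.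
  by_contra hcε
  have h₁ := hyα ε hε
  have h₂ : ⁅(coroot ε : L), c ε⁆ = ε (coroot ε) • c ε :=
    lie_eq_smul_of_mem_rootSpace (hc ε) (coroot ε)
  rw [hzero, add_zero, h₂, hε₂, map_smul, map_smul, hFN' ε (by simp [hε₂]) _ (hc ε), smul_zero,
    add_zero, smul_eq_zero, LieModule.traceForm_comm] at h₁
  have h₃ : ⁅f, c ε⁆ = 0 := by
    rw [← lie_skew, lie_eq_killingForm_smul_of_mem_rootSpace_of_mem_rootSpace_neg (hc ε) hf,
      h₁.resolve_left two_ne_zero, zero_smul, neg_zero]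
  obtain ⟨n, hn⟩ := exists_nat_of_lie_eq_zero' hε₀ t he hf (hc ε) hcε h₃
  rw [hε₂, neg_eq_iff_add_eq_zero] at hn
  have : 2 + n = 0 := by exact_mod_cast hn
  lia

end IsClosedPositive

end Cascade

/-! ### Brackets of root spaces -/

section RootClosed

variable {K L : Type*} [Field K] [CharZero K] [IsAlgClosed K] [LieRing L] [LieAlgebra K L]
  [FiniteDimensional K L] [IsKilling K L]
  {H : LieSubalgebra K L} [H.IsCartanSubalgebra]

lemma exists_smul_eq_of_mem_rootSpace {β : LieModule.Weight K H L} (hβ : β.IsNonZero) {u v : L}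
    (hu : u ∈ rootSpace H β) (hu₀ : u ≠ 0) (hv : v ∈ rootSpace H β) : ∃ c : K, c • u = v := by
  obtain ⟨c, hc⟩ := (finrank_eq_one_iff_of_nonzero' (⟨u, hu⟩ : rootSpace H β)
    (fun h => hu₀ congr(Subtype.val $h))).mp (finrank_rootSpace_eq_one β hβ) ⟨v, hv⟩
  exact ⟨c, congr(Subtype.val $hc)⟩

/-- The bracket of two root spaces is nonzero if the sum of the roots is a weight. -/
lemma lie_ne_zero_of_eq_add {α β γ : LieModule.Weight K H L} (hα : α.IsNonZero)
    (hβ : β.IsNonZero) (hγ : (γ : H → K) = α + β) {h e f v : L} (t : IsSl2Triple h e f)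
    (he : e ∈ rootSpace H α) (hf : f ∈ rootSpace H (-α)) (hv : v ∈ rootSpace H β)
    (hv₀ : v ≠ 0) : ⁅e, v⁆ ≠ 0 := by
  intro hev
  obtain ⟨n, hn⟩ := exists_nat_of_lie_eq_zero hα t he hf hv hv₀ hev
  obtain ⟨w, hw, hw₀⟩ := γ.exists_ne_zero
  have hnil : ∃ k : ℕ, (LieModule.toEnd K L L e ^ k : Module.End K L) w = 0 := by
    obtain ⟨k, hk⟩ := isNilpotent_ad_of_mem_rootSpace H hα he
    exact ⟨k, congr($hk w)⟩
  -- Climb from `γ` to the top vector `u` of its `α`-string, of weight `n + 2 + 2 * k` for the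
  -- coroot. Descending `k + 1` steps lands in the line of `v`, which `e` is assumed to kill,
  -- whereas the `sl₂` relations give the nonzero multiple `(k + 1) * (n + 2 + k)` of the previous
  -- vector.
  obtain ⟨k, hk, hk'⟩ := Nat.exists_not_and_succ_of_not_zero_of_exists
    (p := fun k => (LieModule.toEnd K L L e ^ k : Module.End K L) w = 0) (by simpa using hw₀) hnil
  set u := (LieModule.toEnd K L L e ^ k : Module.End K L) w with hu
  have hu' : u ∈ rootSpace H (k • (α : H → K) + γ) := toEnd_pow_apply_mem he hw k
  have P : t.HasPrimitiveVectorWith u ((n + 2 + 2 * k : ℕ) : K) :=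
    { ne_zero := hk
      lie_h := by
        have : ⁅(coroot α : L), u⁆ = _ := lie_eq_smul_of_mem_rootSpace hu' (coroot α)
        rw [t.h_eq_coroot hα he hf, this, hγ]
        congr 1
        rw [Pi.add_apply, Pi.smul_apply, Pi.add_apply, hn, root_apply_coroot hα, nsmul_eq_mul]
        push_cast
        ring
      lie_e := by
        rw [pow_succ'] at hk'
        exact hk' }
  have hmem : (LieModule.toEnd K L L f ^ (k + 1) : Module.End K L) u ∈ rootSpace H β := by
    have := toEnd_pow_apply_mem hf hu' (k + 1)
    rwa [hγ, show (k + 1) • (-(α : H → K)) + (k • (α : H → K) + (α + β)) = β by module] at this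
  obtain ⟨c, hc⟩ := exists_smul_eq_of_mem_rootSpace hβ hv hv₀ hmem
  have h₁ := P.lie_e_pow_succ_toEnd_f k
  rw [← hc, lie_smul, hev, smul_zero, eq_comm, smul_eq_zero] at h₁
  rcases h₁ with h₁ | h₁
  · have : (k + 1) * (n + 2 + k) = 0 := by
      have h : (((k + 1) * (n + 2 + k) : ℕ) : K) = 0 := by
        rw [← h₁]
        push_cast
        ring
      exact_mod_cast h
    simp at this
  · exact P.pow_toEnd_f_ne_zero_of_eq_nat rfl (by lia) h₁

/-- The roots of a subalgebra are closed under addition. -/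
lemma rootSpace_le_of_eq_add {q : LieSubalgebra K L} {α β γ : LieModule.Weight K H L}
    (hα : α.IsNonZero) (hβ : β.IsNonZero) (hγ₀ : γ.IsNonZero) (hγ : (γ : H → K) = α + β)
    (hαq : (rootSpace H α).toSubmodule ≤ q.toSubmodule)
    (hβq : (rootSpace H β).toSubmodule ≤ q.toSubmodule) :
    (rootSpace H γ).toSubmodule ≤ q.toSubmodule := by
  obtain ⟨h, e, f, t, he, hf⟩ := exists_isSl2Triple_of_weight_isNonZero hα
  obtain ⟨v, hv, hv₀⟩ := β.exists_ne_zero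
  have hne := lie_ne_zero_of_eq_add hα hβ hγ t he hf hv hv₀
  intro w hw
  obtain ⟨c, rfl⟩ := exists_smul_eq_of_mem_rootSpace hγ₀
    (hγ ▸ lie_mem_rootSpace_add he hv) hne hw
  exact q.smul_mem c (q.lie_mem (hαq he) (hβq hv))

end RootClosed

/-! ### Contraction of the bracket form of a graded subalgebra -/

section Contraction

variable {K L : Type*} [Field K] [CharZero K] [LieRing L] [LieAlgebra K L]
  [FiniteDimensional K L]

lemma index_le_finrank_ker {q : LieSubalgebra K L} (g : Dual K q) :
    index K q ≤ finrank K (LinearMap.ker (coadjointForm K q g)) :=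
  ciInf_le (OrderBot.bddBelow _) g

lemma finrank_range_compl₁₂_le {V : Type*} [AddCommGroup V] [Module K V] [FiniteDimensional K V]
    (B : LinearMap.BilinForm K V) (D : V →ₗ[K] V) :
    finrank K (LinearMap.range (B.compl₁₂ D D)) ≤ finrank K (LinearMap.range B) := by
  have h : LinearMap.range (B.compl₁₂ D D) ≤ (LinearMap.range B).map D.dualMap := by
    rintro _ ⟨v, rfl⟩
    exact ⟨B (D v), ⟨D v, rfl⟩, rfl⟩
  exact (Submodule.finrank_mono h).trans (Submodule.finrank_map_le _ _)

/-- The form obtained from `f ⁅u, v⁆` on a graded subalgebra by keeping only the pairs of degrees of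
the same sign. -/
def IsContraction (x : L) {q : LieSubalgebra K L} (f : Dual K L) (B : LinearMap.BilinForm K q) :
    Prop :=
  ∀ (i j : ℤ) (u v : q), (u : L) ∈ gradedPart K x i → (v : L) ∈ gradedPart K x j →
    B u v = if |i + j| = |i| + |j| then f ⁅(u : L), (v : L)⁆ else 0

/-- The index of a graded subalgebra is at most the dimension of the kernel of a contracted
form. -/
theorem exists_contraction {x : L} (hx : IsGrading K x) (q : LieSubalgebra K L) (hxq : x ∈ q)
    (f : Dual K L) :
    ∃ B : LinearMap.BilinForm K q, index K q ≤ finrank K (LinearMap.ker B) ∧ IsContraction x f B := by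
  obtain ⟨s, hs⟩ := hx.exists_sum_proj_eq
  have hq (i : ℤ) : ∀ v ∈ q.toSubmodule, hx.proj i v ∈ q.toSubmodule := fun v hv =>
    hx.proj_mem_of_invariant (fun w hw => q.lie_mem hxq hw) hv i
  let π (i : ℤ) : q →ₗ[K] q := (hx.proj i).restrict (hq i)
  have hπ (i : ℤ) (v : q) : (π i v : L) = hx.proj i v := rfl
  have hs' (v : q) : ∑ i ∈ s, π i v = v := Subtype.ext (by simpa [hπ] using hs v)
  have hππ (i j : ℤ) (v : q) (hv : (v : L) ∈ gradedPart K x j) :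
      π i v = if i = j then v else 0 := by
    split_ifs with h
    · exact Subtype.ext (hx.proj_of_mem (h ▸ hv))
    · exact Subtype.ext (hx.proj_of_mem_of_ne hv (Ne.symm h))
  let Φ := coadjointForm K q (f ∘ₗ q.toSubmodule.subtype)
  let b (i j : ℤ) : LinearMap.BilinForm K q := Φ.compl₁₂ (π i) (π j)
  -- The defect in the triangle inequality, so the subtraction does not truncate. It vanishes
  -- exactly when `i` and `j` do not have opposite signs; at `t = 0` only these terms survive.
  let n (i j : ℤ) : ℕ := i.natAbs + j.natAbs - (i + j).natAbs
  let B (t : K) : LinearMap.BilinForm K q := ∑ i ∈ s, ∑ j ∈ s, t ^ n i j • b i j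
  have hmem {v : q} (hv : v ≠ 0) {i : ℤ} (hi : (v : L) ∈ gradedPart K x i) : i ∈ s := by
    by_contra h
    refine hv ((hs' v).symm.trans (Finset.sum_eq_zero fun j hj => ?_))
    rw [hππ j i v hi, if_neg]
    rintro rfl
    exact h hj
  have hB (t : K) (i j : ℤ) (u v : q) (hu : (u : L) ∈ gradedPart K x i)
      (hv : (v : L) ∈ gradedPart K x j) : B t u v = t ^ n i j * f ⁅(u : L), (v : L)⁆ := by
    by_cases hu₀ : u = 0
    · simp [hu₀]
    by_cases hv₀ : v = 0
    · simp [hv₀]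
    simp only [B, LinearMap.sum_apply, LinearMap.smul_apply, b, LinearMap.compl₁₂_apply,
      hππ _ i u hu, hππ _ j v hv]
    rw [Finset.sum_eq_single_of_mem i (hmem hu₀ hu), Finset.sum_eq_single_of_mem j (hmem hv₀ hv)]
    · simp only [if_true, Φ, coadjointForm, LinearMap.mk₂_apply]
      rfl
    · intro k _ hk
      simp [hk]
    · intro k _ hk
      simp [hk]
  have hpoly : IsPolynomialFamily B := IsPolynomialFamily.sum s fun i _ =>
    IsPolynomialFamily.sum s fun j _ => by
      simpa using (IsPolynomialFamily.const (b i j)).eval_smul (Polynomial.X ^ n i j)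
  obtain ⟨t, ht⟩ := ((hpoly.finite_setOf_finrank_range_lt 0).union
    (Set.finite_singleton (0 : K))).infinite_compl.nonempty
  rw [Set.mem_compl_iff, Set.mem_union, not_or, Set.mem_ofPred_eq, not_lt] at ht
  have ht₀ : t ≠ 0 := ht.2
  -- For `t ≠ 0` the deformed form is the bracket form of the rescaled `g`, pulled back by the
  -- scaling `D`, so its rank is at most that of a true bracket form.
  let D : q →ₗ[K] q := ∑ i ∈ s, t ^ i.natAbs • π i
  let g : Dual K q := ∑ i ∈ s, (t ^ i.natAbs)⁻¹ • (f ∘ₗ q.toSubmodule.subtype ∘ₗ π i)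
  have hD (i : ℤ) (u : q) (hu : (u : L) ∈ gradedPart K x i) : D u = t ^ i.natAbs • u := by
    by_cases hu₀ : u = 0
    · simp [hu₀]
    simp only [D, LinearMap.sum_apply, LinearMap.smul_apply, hππ _ i u hu]
    rw [Finset.sum_eq_single_of_mem i (hmem hu₀ hu)]
    · simp
    · intro k _ hk
      simp [hk]
  have hg (i : ℤ) (u : q) (hu : (u : L) ∈ gradedPart K x i) :
      g u = (t ^ i.natAbs)⁻¹ * f u := by
    by_cases hu₀ : u = 0
    · simp [hu₀]
    simp only [g, LinearMap.sum_apply, LinearMap.smul_apply, LinearMap.comp_apply, hππ _ i u hu]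
    rw [Finset.sum_eq_single_of_mem i (hmem hu₀ hu)]
    · simp
    · intro k _ hk
      simp [hk]
  have hBt : B t = (coadjointForm K q g).compl₁₂ D D := by
    have key (i j : ℤ) (u v : q) (hu : (u : L) ∈ gradedPart K x i)
        (hv : (v : L) ∈ gradedPart K x j) : B t u v = g ⁅D u, D v⁆ := by
      rw [hB t i j u v hu hv, hD i u hu, hD j v hv, smul_lie, lie_smul, map_smul, map_smul,
        hg (i + j) ⁅u, v⁆ (lie_mem_gradedPart hu hv), smul_eq_mul, smul_eq_mul, ← mul_assoc,
        ← mul_assoc, LieSubalgebra.coe_bracket, ← pow_add]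
      congr 1
      rw [eq_mul_inv_iff_mul_eq₀ (pow_ne_zero _ ht₀), ← pow_add]
      congr 1
      have := Int.natAbs_add_le i j
      simp only [n]
      lia
    refine LinearMap.ext₂ fun u v => ?_
    rw [← hs' u, ← hs' v]
    simp only [map_sum, LinearMap.sum_apply]
    refine Finset.sum_congr rfl fun i _ => Finset.sum_congr rfl fun j _ => ?_
    exact key j i _ _ (hx.proj_mem j u) (hx.proj_mem i v)
  refine ⟨B 0, ?_, fun i j u v hu hv => ?_⟩
  · refine (index_le_finrank_ker g).trans ?_
    have h₁ := finrank_range_compl₁₂_le (coadjointForm K q g) D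
    rw [← hBt] at h₁
    have h₂ := (coadjointForm K q g).finrank_range_add_finrank_ker
    have h₃ := (B 0).finrank_range_add_finrank_ker
    have h₄ := ht.1
    lia
  · rw [hB 0 i j u v hu hv]
    have hiff : n i j = 0 ↔ |i + j| = |i| + |j| := by
      simp only [n, Int.abs_eq_natAbs]
      have := Int.natAbs_add_le i j
      lia
    split_ifs with h
    · rw [hiff.mpr h, pow_zero, one_mul]
    · rw [zero_pow (mt hiff.mp h), zero_mul]

end Contraction

/-! ### Evaluating a contracted form -/

section Contraction

variable {K L : Type*} [Field K] [CharZero K] [LieRing L] [LieAlgebra K L]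
  [FiniteDimensional K L]

lemma IsGrading.proj_eq_zero_of_mem_upper_neg {x v : L} (hx : IsGrading K x) {j k : ℤ}
    (hv : v ∈ upper K (-x) k) (h : -k < j) : hx.proj j v = 0 := by
  induction hv using upper_induction with
  | h₀ => simp
  | hadd _ _ _ _ h₁ h₂ => rw [map_add, h₁, h₂, add_zero]
  | h i hi w hw =>
    rw [gradedPart_neg] at hw
    exact hx.proj_of_mem_of_ne hw (by lia)

namespace IsContraction

variable {x : L} {q : LieSubalgebra K L} {f : Dual K L} {B : LinearMap.BilinForm K q}

lemma neg (hB : IsContraction x f B) : IsContraction (-x) f B := fun i j u v hu hv => by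
  rw [gradedPart_neg] at hu hv
  rw [hB (-i) (-j) u v hu hv, abs_neg, abs_neg, ← neg_add, abs_neg]

lemma bilin_eq_sum (hx : IsGrading K x) (hxq : x ∈ q) :
    ∃ s : Finset ℤ, ∀ u v : q, B u v = ∑ i ∈ s, ∑ j ∈ s,
      B ⟨hx.proj i u, hx.proj_mem_of_invariant (q := q.toSubmodule)
          (fun _ hw => q.lie_mem hxq hw) u.2 i⟩
        ⟨hx.proj j v, hx.proj_mem_of_invariant (q := q.toSubmodule)
          (fun _ hw => q.lie_mem hxq hw) v.2 j⟩ := by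
  obtain ⟨s, hs⟩ := hx.exists_sum_proj_eq
  refine ⟨s, fun u v => ?_⟩
  have h (w : q) : w = ∑ i ∈ s, (⟨hx.proj i w, hx.proj_mem_of_invariant (q := q.toSubmodule)
      (fun _ hw => q.lie_mem hxq hw) w.2 i⟩ : q) := Subtype.ext (by simpa using (hs w).symm)
  conv_lhs => rw [h u, h v]
  simp only [map_sum, LinearMap.sum_apply]
  exact Finset.sum_comm

lemma apply_of_mem_upper (hB : IsContraction x f B) (hx : IsGrading K x) (hxq : x ∈ q) {u v : q}
    (hu : (u : L) ∈ upper K x 0) (hv : (v : L) ∈ upper K x 0) : B u v = f ⁅(u : L), (v : L)⁆ := by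
  obtain ⟨s, hs⟩ := bilin_eq_sum (B := B - coadjointForm K q (f ∘ₗ q.toSubmodule.subtype)) hx hxq
  rw [← sub_eq_zero]
  refine (hs u v).trans (Finset.sum_eq_zero fun i _ => Finset.sum_eq_zero fun j _ => ?_)
  rw [hx.mem_upper_iff] at hu hv
  rw [LinearMap.sub_apply, LinearMap.sub_apply, sub_eq_zero]
  refine (hB i j _ _ (hx.proj_mem i u) (hx.proj_mem j v)).trans ?_
  change _ = f ⁅hx.proj i u, hx.proj j v⁆
  rcases lt_or_ge i 0 with hi | hi
  · simp [hu i hi]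
  rcases lt_or_ge j 0 with hj | hj
  · simp [hv j hj]
  rw [if_pos (abs_add_eq_add_abs_iff i j |>.mpr (Or.inl ⟨hi, hj⟩))]

lemma apply_eq_zero (hB : IsContraction x f B) (hx : IsGrading K x) (hxq : x ∈ q) {u v : q}
    (hu : (u : L) ∈ upper K x 1) (hv : (v : L) ∈ upper K (-x) 1) : B u v = 0 := by
  obtain ⟨s, hs⟩ := bilin_eq_sum (B := B) hx hxq
  refine (hs u v).trans (Finset.sum_eq_zero fun i _ => Finset.sum_eq_zero fun j _ => ?_)
  rw [hx.mem_upper_iff] at hu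
  refine (hB i j _ _ (hx.proj_mem i u) (hx.proj_mem j v)).trans ?_
  rcases lt_or_ge i 1 with hi | hi
  · simp [hu i hi]
  rcases lt_or_ge j 0 with hj | hj
  · rw [if_neg]
    rw [abs_add_eq_add_abs_iff]
    lia
  · simp [hx.proj_eq_zero_of_mem_upper_neg hv (show -1 < j by lia)]

end IsContraction

end Contraction

/-! ### Bounding the index by isotropic forms on the Cartan subalgebra -/

section Count

/-- Rank–nullity for `π`: its range lies in the annihilator of `E ⊔ E'`, and `θ` embeds its kernel
in `E ⊓ E'`. It is applied with `W` the kernel of the contracted form and `V` the Cartan subalgebra.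
-/
lemma finrank_add_finrank_sup_le {K W V : Type*} [Field K] [AddCommGroup W] [Module K W]
    [AddCommGroup V] [Module K V] [FiniteDimensional K W] [FiniteDimensional K V]
    {E E' : Submodule K (Dual K V)} (π : W →ₗ[K] V) (θ : W →ₗ[K] Dual K V)
    (hπ : ∀ w, ∀ φ ∈ E ⊔ E', φ (π w) = 0) (hθ : ∀ w, π w = 0 → θ w ∈ E ⊓ E')
    (h : ∀ w, π w = 0 → θ w = 0 → w = 0) :
    finrank K W + finrank K (E ⊔ E' : Submodule K (Dual K V)) ≤
      finrank K V + finrank K (E ⊓ E' : Submodule K (Dual K V)) := by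
  have h₁ : LinearMap.range π ≤ (E ⊔ E').dualCoannihilator := by
    rintro _ ⟨w, rfl⟩
    rw [Submodule.mem_dualCoannihilator]
    exact hπ w
  have h₂ := Submodule.finrank_mono h₁
  have h₃ := Subspace.finrank_add_finrank_dualCoannihilator_eq (E ⊔ E')
  have h₄ := π.finrank_range_add_finrank_ker
  let θ' : LinearMap.ker π →ₗ[K] (E ⊓ E' : Submodule K (Dual K V)) :=
    (θ ∘ₗ (LinearMap.ker π).subtype).codRestrict _ fun w => hθ w w.2
  have h₅ : finrank K (LinearMap.ker π) ≤ finrank K (E ⊓ E' : Submodule K (Dual K V)) := by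
    refine LinearMap.finrank_le_finrank_of_injective (f := θ')
      ((injective_iff_map_eq_zero θ').mpr ?_)
    exact fun w hw => Subtype.ext (h w w.2 congr(Subtype.val $hw))
  lia

variable {K L : Type*} [Field K] [CharZero K] [IsAlgClosed K] [LieRing L] [LieAlgebra K L]
  [FiniteDimensional K L] [IsKilling K L]
  {H : LieSubalgebra K L} [H.IsCartanSubalgebra]

lemma IsHeight.neg {z : H} {ht : LieModule.Weight K H L → ℤ} (h : IsHeight z ht) :
    IsHeight (-z) (fun χ => -ht χ) where
  apply_eq χ := by
    rw [Int.cast_neg, ← h.apply_eq, ← LieModule.Weight.toLinear_apply, map_neg,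
      LieModule.Weight.toLinear_apply]
  ne_zero χ hχ := neg_ne_zero.mpr (h.ne_zero χ hχ)

lemma IsHeight.isGrading {z : H} {ht : LieModule.Weight K H L → ℤ} (h : IsHeight z ht) :
    IsGrading K (z : L) :=
  isGrading_of_forall_root z fun χ _ => ⟨ht χ, h.apply_eq χ⟩

lemma IsHeight.gradedPart_zero {z : H} {ht : LieModule.Weight K H L → ℤ} (h : IsHeight z ht) :
    gradedPart K (z : L) 0 = H.toSubmodule :=
  gradedPart_zero_eq z fun χ hχ => by
    rw [h.apply_eq]
    exact_mod_cast h.ne_zero χ hχ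

open Classical in
/-- The roots of positive height whose root space is contained in a subalgebra. -/
noncomputable def rootsIn (ht : LieModule.Weight K H L → ℤ) (q : LieSubalgebra K L) :
    Finset (LieModule.Weight K H L) :=
  {α | 0 < ht α ∧ (rootSpace H α).toSubmodule ≤ q.toSubmodule}

lemma mem_rootsIn {ht : LieModule.Weight K H L → ℤ} {q : LieSubalgebra K L}
    {α : LieModule.Weight K H L} :
    α ∈ rootsIn ht q ↔ 0 < ht α ∧ (rootSpace H α).toSubmodule ≤ q.toSubmodule := by
  simp [rootsIn]

lemma weightSum_rootsIn_le (ht : LieModule.Weight K H L → ℤ) (q : LieSubalgebra K L) :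
    weightSum (rootsIn ht q) ≤ q.toSubmodule :=
  iSup₂_le fun _ hα => (mem_rootsIn.mp hα).2

lemma IsHeight.weightSum_rootsIn_le_upper {z : H} {ht : LieModule.Weight K H L → ℤ}
    (h : IsHeight z ht) (q : LieSubalgebra K L) :
    weightSum (rootsIn ht q) ≤ upper K (z : L) 1 :=
  iSup₂_le fun α hα => (rootSpace_le_gradedPart (h.apply_eq α)).trans
    (gradedPart_le_upper _ (mem_rootsIn.mp hα).1)

lemma rootSpace_le_of_mem {q : Submodule K L} {α : LieModule.Weight K H L} (hα : α.IsNonZero)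
    {v : L} (hv : v ∈ rootSpace H α) (hv₀ : v ≠ 0) (hvq : v ∈ q) :
    (rootSpace H α).toSubmodule ≤ q := fun w hw => by
  obtain ⟨c, rfl⟩ := exists_smul_eq_of_mem_rootSpace hα hv hv₀ hw
  exact q.smul_mem c hvq

/-- The triangular decomposition of a subalgebra containing a Cartan subalgebra. -/
lemma IsHeight.exists_decomposition {z : H} {ht : LieModule.Weight K H L → ℤ}
    (h : IsHeight z ht) {q : LieSubalgebra K L} (hq : H ≤ q) {y : L} (hy : y ∈ q) :
    ∃ y₀ ∈ H, ∃ y₁ ∈ weightSum (rootsIn ht q), ∃ y₂ ∈ weightSum (rootsIn (fun χ => -ht χ) q),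
      y₀ + y₁ + y₂ = y := by
  have : q.toSubmodule ≤ H.toSubmodule ⊔ weightSum (rootsIn ht q) ⊔
      weightSum (rootsIn (fun χ => -ht χ) q) := by
    refine le_of_forall_weight H (fun h hh v hv => q.lie_mem (hq hh) hv) fun χ v hv hχ => ?_
    by_cases hv₀ : v = 0
    · rw [hv₀]; exact zero_mem _
    by_cases hχ₀ : χ.IsZero
    · exact Submodule.mem_sup_left
        (Submodule.mem_sup_left (mem_cartan_of_mem_rootSpace_zero hχ₀ hχ))
    have hle := rootSpace_le_of_mem hχ₀ hχ hv₀ hv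
    rcases (h.ne_zero χ hχ₀).lt_or_gt with hlt | hlt
    · exact Submodule.mem_sup_right (rootSpace_le_weightSum
        (mem_rootsIn.mpr ⟨neg_pos.mpr hlt, hle⟩) hχ)
    · exact Submodule.mem_sup_left (Submodule.mem_sup_right (rootSpace_le_weightSum
        (mem_rootsIn.mpr ⟨hlt, hle⟩) hχ))
  obtain ⟨_, h₀₁, y₂, h₂, rfl⟩ := Submodule.mem_sup.mp (this hy)
  obtain ⟨y₀, h₀, y₁, h₁, rfl⟩ := Submodule.mem_sup.mp h₀₁
  exact ⟨y₀, h₀, y₁, h₁, y₂, h₂, rfl⟩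

/-- The vectors of the sum of the root spaces of `N` which are orthogonal to it for the form
`F ⁅x, y⁆`. -/
def isotropy (F : Dual K L) (N : Finset (LieModule.Weight K H L)) : Submodule K L where
  carrier := {y | y ∈ weightSum N ∧ ∀ x ∈ weightSum N, F ⁅x, y⁆ = 0}
  zero_mem' := ⟨zero_mem _, by simp⟩
  add_mem' hu hv := ⟨add_mem hu.1 hv.1, fun x hx => by
    rw [lie_add, map_add, hu.2 x hx, hv.2 x hx, add_zero]⟩
  smul_mem' c u hu := ⟨Submodule.smul_mem _ c hu.1, fun x hx => by
    rw [lie_smul, map_smul, hu.2 x hx, smul_zero]⟩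

variable (H) in
/-- The linear form `h ↦ F ⁅h, y⁆` on the Cartan subalgebra. -/
def cartanDual (F : Dual K L) : L →ₗ[K] Dual K H :=
  LinearMap.mk₂ K (fun y (h : H) => F ⁅(h : L), y⁆) (by simp) (by simp) (by simp) (by simp)

lemma cartanDual_apply (F : Dual K L) (y : L) (h : H) : cartanDual H F y h = F ⁅(h : L), y⁆ := rfl

/-- The linear forms on the Cartan subalgebra induced by isotropic vectors. -/
def isotropyDual (F : Dual K L) (N : Finset (LieModule.Weight K H L)) :
    Submodule K (Dual K H) :=
  (isotropy F N).map (cartanDual H F)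

/-- A linear form concentrated in the weights `N`, which is nondegenerate on their sum relative to
the Cartan subalgebra. -/
structure IsNondegenerateOn (F : Dual K L) (N : Finset (LieModule.Weight K H L)) : Prop where
  apply_eq_zero : ∀ χ : LieModule.Weight K H L, χ ∉ N → ∀ v ∈ rootSpace H χ, F v = 0
  eq_zero : ∀ y ∈ isotropy F N, cartanDual H F y = 0 → y = 0

lemma IsClosedPositive.exists_isNondegenerateOn {z : H} {ht : LieModule.Weight K H L → ℤ}
    {N : Finset (LieModule.Weight K H L)} (hz : IsHeight z ht) (hN : IsClosedPositive ht N) :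
    ∃ F : Dual K L, IsNondegenerateOn F N := by
  obtain ⟨F, hF, hF'⟩ := hN.exists_dual hz
  refine ⟨F, fun χ hχ => hF χ fun γ hγ h => hχ ?_, fun y hy hy' => hF' y hy.1 hy.2 fun α _ =>
    congr($hy' (coroot α))⟩
  rwa [← DFunLike.coe_injective h]

namespace IsNondegenerateOn

variable {z : H} {ht : LieModule.Weight K H L → ℤ} {q : LieSubalgebra K L} {F F' : Dual K L}

lemma apply_eq_zero_of_mem_upper (hz : IsHeight z ht) (hF : IsNondegenerateOn F (rootsIn ht q))
    {v : L} (hv : v ∈ upper K (-(z : L)) 0) : F v = 0 := by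
  suffices upper K (-(z : L)) 0 ≤ LinearMap.ker F from this hv
  refine iSup₂_le fun i hi => ?_
  rw [gradedPart_neg]
  refine le_of_forall_weight H (fun h hh v hv => lie_mem_gradedPart_of_mem_cartan z hh hv)
    fun χ v hv hχ => ?_
  by_cases hv₀ : v = 0
  · rw [hv₀]; exact zero_mem _
  refine hF.apply_eq_zero χ (fun h => ?_) v hχ
  have h₁ := apply_eq_of_mem_gradedPart hχ hv₀ hv
  rw [hz.apply_eq, Int.cast_inj] at h₁
  have h₂ := (mem_rootsIn.mp h).1
  lia

/-- The components of a vector of the kernel of a contracted form are isotropic. -/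
lemma apply_lie_eq_zero {B : LinearMap.BilinForm K q} (hz : IsHeight z ht) (hq : H ≤ q)
    (hF' : IsNondegenerateOn F' (rootsIn (fun χ => -ht χ) q))
    (hB : IsContraction (z : L) (F + F') B) {y₀ y₁ y₂ : L} (h₀ : y₀ ∈ H)
    (h₁ : y₁ ∈ weightSum (rootsIn ht q)) (h₂ : y₂ ∈ weightSum (rootsIn (fun χ => -ht χ) q))
    {y : q} (hy : y ∈ LinearMap.ker B) (hy' : y₀ + y₁ + y₂ = y) {u : L}
    (hu : u ∈ weightSum (rootsIn ht q)) : F ⁅y₀ + y₁, u⁆ = 0 := by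
  have hzq : (z : L) ∈ q := hq z.2
  have h₁q : y₀ + y₁ ∈ q := add_mem (hq h₀) (weightSum_rootsIn_le ht q h₁)
  have h₂q : y₂ ∈ q := weightSum_rootsIn_le _ q h₂
  have huq : u ∈ q := weightSum_rootsIn_le _ q hu
  have h₁u : y₀ + y₁ ∈ upper K (z : L) 0 := by
    refine add_mem (gradedPart_le_upper _ le_rfl ?_)
      (upper_mono _ zero_le_one (hz.weightSum_rootsIn_le_upper q h₁))
    rwa [hz.gradedPart_zero]
  have h₂u : y₂ ∈ upper K (-(z : L)) 1 := hz.neg.weightSum_rootsIn_le_upper q h₂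
  have huu : u ∈ upper K (z : L) 1 := hz.weightSum_rootsIn_le_upper q hu
  have huu' : u ∈ upper K (z : L) 0 := upper_mono _ zero_le_one huu
  have hsum : y = ⟨y₀ + y₁, h₁q⟩ + ⟨y₂, h₂q⟩ := Subtype.ext hy'.symm
  -- Pairing `y` with `u` of positive degree: the contraction discards `y₂`, and `F'` vanishes on
  -- what remains.
  have h := congr($(LinearMap.mem_ker.mp hy) ⟨u, huq⟩)
  rw [hsum, map_add, LinearMap.add_apply, hB.apply_of_mem_upper hz.isGrading hzq h₁u huu',
    hB.neg.apply_eq_zero hz.isGrading.neg (neg_mem hzq) h₂u (by rwa [neg_neg]), add_zero,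
    LinearMap.add_apply] at h
  have h₃ : F' ⁅y₀ + y₁, u⁆ = 0 := by
    refine hF'.apply_eq_zero_of_mem_upper hz.neg ?_
    have := lie_mem_upper h₁u huu'
    rw [zero_add] at this
    simpa using this
  rw [h₃, add_zero] at h
  exact h

/-- Degree zero pairs with both signs under the contraction, so testing against the Cartan
subalgebra links the two halves. This relation puts the induced form in both `E` and `E'`. -/
lemma apply_lie_add_eq_zero {B : LinearMap.BilinForm K q} (hz : IsHeight z ht) (hq : H ≤ q)
    (hF : IsNondegenerateOn F (rootsIn ht q))
    (hF' : IsNondegenerateOn F' (rootsIn (fun χ => -ht χ) q))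
    (hB : IsContraction (z : L) (F + F') B) {y₁ y₂ : L}
    (h₁ : y₁ ∈ weightSum (rootsIn ht q)) (h₂ : y₂ ∈ weightSum (rootsIn (fun χ => -ht χ) q))
    {y : q} (hy : y ∈ LinearMap.ker B) (hy' : y₁ + y₂ = y) {h : L}
    (hh : h ∈ H) : F ⁅h, y₁⁆ + F' ⁅h, y₂⁆ = 0 := by
  have hzq : (z : L) ∈ q := hq z.2
  have h₁q : y₁ ∈ q := weightSum_rootsIn_le ht q h₁
  have h₂q : y₂ ∈ q := weightSum_rootsIn_le _ q h₂
  have hh₀ : h ∈ upper K (z : L) 0 := by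
    refine gradedPart_le_upper _ le_rfl ?_
    rwa [hz.gradedPart_zero]
  have hh₀' : h ∈ upper K (-(z : L)) 0 := by
    refine gradedPart_le_upper _ le_rfl ?_
    rwa [gradedPart_neg, neg_zero, hz.gradedPart_zero]
  have h₁u : y₁ ∈ upper K (z : L) 0 :=
    upper_mono _ zero_le_one (hz.weightSum_rootsIn_le_upper q h₁)
  have h₂u : y₂ ∈ upper K (-(z : L)) 0 :=
    upper_mono _ zero_le_one (hz.neg.weightSum_rootsIn_le_upper q h₂)
  have hsum : y = ⟨y₁, h₁q⟩ + ⟨y₂, h₂q⟩ := Subtype.ext hy'.symm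
  have e := congr($(LinearMap.mem_ker.mp hy) ⟨h, hq hh⟩)
  rw [hsum, map_add, LinearMap.add_apply, hB.apply_of_mem_upper hz.isGrading hzq h₁u hh₀,
    hB.neg.apply_of_mem_upper hz.isGrading.neg (neg_mem hzq) h₂u hh₀',
    LinearMap.add_apply, LinearMap.add_apply] at e
  have h₃ : F' ⁅y₁, h⁆ = 0 := by
    refine hF'.apply_eq_zero_of_mem_upper hz.neg ?_
    have := lie_mem_upper h₁u hh₀
    rw [zero_add] at this
    simpa using this
  have h₄ : F ⁅y₂, h⁆ = 0 := by
    refine hF.apply_eq_zero_of_mem_upper hz ?_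
    have := lie_mem_upper h₂u hh₀'
    rwa [zero_add] at this
  rw [h₃, h₄, add_zero, zero_add] at e
  rw [← lie_skew, ← lie_skew h y₂, map_neg, map_neg, ← neg_add, neg_eq_zero]
  exact e

/-- The isotropic forms of the two halves of a subalgebra bound its index. -/
theorem index_add_finrank_le (hz : IsHeight z ht) (hq : H ≤ q)
    (hF : IsNondegenerateOn F (rootsIn ht q))
    (hF' : IsNondegenerateOn F' (rootsIn (fun χ => -ht χ) q)) :
    index K q + finrank K (isotropyDual F (rootsIn ht q) ⊔
        isotropyDual F' (rootsIn (fun χ => -ht χ) q) : Submodule K (Dual K H)) ≤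
      finrank K H + finrank K (isotropyDual F (rootsIn ht q) ⊓
        isotropyDual F' (rootsIn (fun χ => -ht χ) q) : Submodule K (Dual K H)) := by
  have hzq : (z : L) ∈ q := hq z.2
  obtain ⟨B, hle, hB⟩ := exists_contraction hz.isGrading q hzq (F + F')
  have hB' : IsContraction (-(z : L)) (F' + F) B := by
    rw [add_comm]
    exact IsContraction.neg hB
  refine (Nat.add_le_add_right hle _).trans ?_
  -- `π` takes the Cartan component of a kernel vector; `θ` takes the form on `H` that it induces
  -- through `F`, which sees only its positive part when the Cartan component is zero.
  let π : LinearMap.ker B →ₗ[K] H :=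
    (hz.isGrading.proj 0 ∘ₗ q.toSubmodule.subtype ∘ₗ (LinearMap.ker B).subtype).codRestrict
      H.toSubmodule fun w => by
        rw [← hz.gradedPart_zero]
        exact hz.isGrading.proj_mem 0 _
  let θ : LinearMap.ker B →ₗ[K] Dual K H :=
    cartanDual H F ∘ₗ q.toSubmodule.subtype ∘ₗ (LinearMap.ker B).subtype
  have hproj {y₀ y₁ y₂ : L} (h₀ : y₀ ∈ H) (h₁ : y₁ ∈ weightSum (rootsIn ht q))
      (h₂ : y₂ ∈ weightSum (rootsIn (fun χ => -ht χ) q)) :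
      hz.isGrading.proj 0 (y₀ + y₁ + y₂) = y₀ := by
    have e₀ : hz.isGrading.proj 0 y₀ = y₀ :=
      hz.isGrading.proj_of_mem (by rwa [hz.gradedPart_zero])
    have e₁ : hz.isGrading.proj 0 y₁ = 0 :=
      hz.isGrading.mem_upper_iff.mp (hz.weightSum_rootsIn_le_upper q h₁) 0 zero_lt_one
    have e₂ : hz.isGrading.proj 0 y₂ = 0 :=
      hz.isGrading.proj_eq_zero_of_mem_upper_neg (hz.neg.weightSum_rootsIn_le_upper q h₂)
        (by simp)
    rw [map_add, map_add, e₀, e₁, e₂, add_zero, add_zero]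
  have hdec (w : LinearMap.ker B) : ∃ y₁ ∈ weightSum (rootsIn ht q),
      ∃ y₂ ∈ weightSum (rootsIn (fun χ => -ht χ) q), ((π w : H) : L) + y₁ + y₂ = (w : q) := by
    obtain ⟨y₀, h₀, y₁, h₁, y₂, h₂, h⟩ := hz.exists_decomposition hq (w : q).2
    refine ⟨y₁, h₁, y₂, h₂, ?_⟩
    have : ((π w : H) : L) = y₀ := by
      change hz.isGrading.proj 0 ((w : q) : L) = y₀
      rw [← h, hproj h₀ h₁ h₂]
    rw [this, h]
  have hiso {w : LinearMap.ker B} (hw : π w = 0) : ∃ y₁ ∈ isotropy F (rootsIn ht q),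
      ∃ y₂ ∈ isotropy F' (rootsIn (fun χ => -ht χ) q), y₁ + y₂ = (w : q) ∧
        θ w = cartanDual H F y₁ ∧ θ w = -cartanDual H F' y₂ := by
    obtain ⟨y₁, h₁, y₂, h₂, h⟩ := hdec w
    have e₁ (u : L) (hu : u ∈ weightSum (rootsIn ht q)) : F ⁅u, y₁⁆ = 0 := by
      have := apply_lie_eq_zero hz hq hF' hB (π w).2 h₁ h₂ w.2 h hu
      rw [hw, ZeroMemClass.coe_zero, zero_add] at this
      rw [← lie_skew, map_neg, this, neg_zero]
    have e₂ (u : L) (hu : u ∈ weightSum (rootsIn (fun χ => -ht χ) q)) : F' ⁅u, y₂⁆ = 0 := by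
      have := apply_lie_eq_zero hz.neg hq (F := F') (F' := F) (by simpa using hF) hB' (π w).2 h₂
        (by simpa using h₁) w.2 (by rw [← h]; abel) hu
      rw [hw, ZeroMemClass.coe_zero, zero_add] at this
      rw [← lie_skew, map_neg, this, neg_zero]
    rw [hw, ZeroMemClass.coe_zero, zero_add] at h
    have e₃ : θ w = cartanDual H F y₁ := by
      refine LinearMap.ext fun k => ?_
      change F ⁅(k : L), ((w : q) : L)⁆ = F ⁅(k : L), y₁⁆
      rw [← h, lie_add, map_add, add_eq_left]
      refine hF.apply_eq_zero_of_mem_upper hz ?_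
      have hk : (k : L) ∈ gradedPart K (-(z : L)) 0 := by
        rw [gradedPart_neg, neg_zero, hz.gradedPart_zero]
        exact k.2
      have := lie_mem_upper (gradedPart_le_upper _ le_rfl hk)
        (hz.neg.weightSum_rootsIn_le_upper q h₂)
      exact upper_mono _ (by simp) this
    refine ⟨y₁, ⟨h₁, e₁⟩, y₂, ⟨h₂, e₂⟩, h, e₃, ?_⟩
    rw [e₃, eq_neg_iff_add_eq_zero]
    exact LinearMap.ext fun k => apply_lie_add_eq_zero hz hq hF hF' hB h₁ h₂ w.2 h k.2
  refine finrank_add_finrank_sup_le π θ (fun w φ hφ => ?_) (fun w hw => ?_) fun w hw hθ => ?_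
  · obtain ⟨y₁, h₁, y₂, h₂, h⟩ := hdec w
    obtain ⟨_, ⟨k, hk, rfl⟩, _, ⟨k', hk', rfl⟩, rfl⟩ := Submodule.mem_sup.mp hφ
    have e₁ : F ⁅((π w : H) : L), k⁆ = 0 := by
      have := apply_lie_eq_zero hz hq hF' hB (π w).2 h₁ h₂ w.2 h hk.1
      rwa [add_lie, map_add, hk.2 y₁ h₁, add_zero] at this
    have e₂ : F' ⁅((π w : H) : L), k'⁆ = 0 := by
      have := apply_lie_eq_zero hz.neg hq (F := F') (F' := F) (by simpa using hF) hB' (π w).2 h₂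
        (by simpa using h₁) w.2 (by rw [← h]; abel) hk'.1
      rwa [add_lie, map_add, hk'.2 y₂ h₂, add_zero] at this
    rw [LinearMap.add_apply, cartanDual_apply, cartanDual_apply, e₁, e₂, add_zero]
  · obtain ⟨y₁, h₁, y₂, h₂, -, e₁, e₂⟩ := hiso hw
    refine ⟨⟨y₁, h₁, e₁.symm⟩, ⟨-y₂, neg_mem h₂, ?_⟩⟩
    rw [map_neg, e₂]
  · obtain ⟨y₁, h₁, y₂, h₂, h, e₁, e₂⟩ := hiso hw
    rw [hθ] at e₁ e₂
    have e₃ := hF.eq_zero y₁ h₁ e₁.symm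
    have e₄ := hF'.eq_zero y₂ h₂ (neg_eq_zero.mp e₂.symm)
    rw [e₃, e₄, add_zero] at h
    exact Subtype.ext (Subtype.ext h.symm)

theorem index_le_finrank (hz : IsHeight z ht) (hq : H ≤ q)
    (hF : IsNondegenerateOn F (rootsIn ht q))
    (hF' : IsNondegenerateOn F' (rootsIn (fun χ => -ht χ) q)) :
    index K q ≤ finrank K H := by
  have h₁ := index_add_finrank_le hz hq hF hF'
  have h₂ := Submodule.finrank_mono (inf_le_sup (a := isotropyDual F (rootsIn ht q))
    (b := isotropyDual F' (rootsIn (fun χ => -ht χ) q)))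
  lia

theorem isotropyDual_eq_of_index_eq (hz : IsHeight z ht) (hq : H ≤ q)
    (hF : IsNondegenerateOn F (rootsIn ht q))
    (hF' : IsNondegenerateOn F' (rootsIn (fun χ => -ht χ) q)) (h : index K q = finrank K H) :
    isotropyDual F (rootsIn ht q) = isotropyDual F' (rootsIn (fun χ => -ht χ) q) := by
  have h₁ := index_add_finrank_le hz hq hF hF'
  rw [h, Nat.add_le_add_iff_left] at h₁
  exact inf_eq_sup.mp (Submodule.eq_of_le_of_finrank_le inf_le_sup h₁)

end IsNondegenerateOn

end Count

/-! ### Pairs containing opposite Borel subalgebras; the case of equality -/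

section Opposite

variable {K L : Type*} [Field K] [CharZero K] [IsAlgClosed K] [LieRing L] [LieAlgebra K L]
  [FiniteDimensional K L] [IsSemisimple K L]
  {H : LieSubalgebra K L} [H.IsCartanSubalgebra] {z : H} {ht : LieModule.Weight K H L → ℤ}

lemma IsHeight.apply_neg (hz : IsHeight z ht) (α : LieModule.Weight K H L) : ht (-α) = -ht α := by
  have h := hz.apply_eq (-α)
  rw [LieModule.Weight.coe_neg, Pi.neg_apply, hz.apply_eq] at h
  exact_mod_cast h.symm

/-- There is a base consisting of roots of positive height. -/
lemma IsHeight.exists_base (hz : IsHeight z ht) :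
    ∃ B : (rootSystem H).Base, ∀ i ∈ B.support, 0 < ht i := by
  -- Indecomposable positive roots are defined by an additive map to an ordered group. A `ℚ`-linear
  -- retraction of `K` onto `ℚ` turns evaluation at `z` into one, with the heights as values on
  -- roots.
  obtain ⟨r, hr⟩ := LinearMap.exists_leftInverse_of_injective (Algebra.linearMap ℚ K)
    (LinearMap.ker_eq_bot.mpr (algebraMap ℚ K).injective)
  have hr' (i : ℤ) : r (i : K) = i := by simpa using congr($hr (i : ℚ))
  let f : Dual K H →+ ℚ := r.toAddMonoidHom.comp
    (LinearMap.applyₗ (R := K) (M₂ := K) z).toAddMonoidHom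
  have hf (i : H.root) : f ((rootSystem H).root i) = ht i := by
    rw [← hr', ← hz.apply_eq]
    rfl
  have hf₀ (i : H.root) : f ((rootSystem H).root i) ≠ 0 := by
    rw [hf]
    exact_mod_cast hz.ne_zero i (isNonZero_iff_mem_root.mpr i.2)
  let := (rootSystem H).indexNeg
  refine ⟨RootPairing.Base.mk' (rootSystem H) (IsAddIndecomposable.baseOf (rootSystem H).root f)
    ((rootSystem H).linearIndepOn_root_baseOf f hf₀) (fun i =>
      IsAddIndecomposable.mem_or_neg_mem_closure_baseOf (rootSystem H).root f i (hf₀ i)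
        (by rw [RootPairing.indexNeg_neg, RootPairing.root_reflectionPerm,
          RootPairing.reflection_apply_self])), fun i hi => ?_⟩
  have hi' : i ∈ IsAddIndecomposable.baseOf (rootSystem H).root f := by
    simpa [RootPairing.Base.mk'] using hi
  have : 0 < f ((rootSystem H).root i) :=
    IsAddIndecomposable.baseOf_subset_pos (rootSystem H).root f hi'
  rw [hf] at this
  exact_mod_cast this

/-- Induction on the roots of positive height, by addition of simple roots. -/
lemma IsHeight.induction (hz : IsHeight z ht) {B : (rootSystem H).Base}
    (hB : ∀ i ∈ B.support, 0 < ht i) {P : LieModule.Weight K H L → Prop}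
    (simple : ∀ i ∈ B.support, P i)
    (add : ∀ α β γ : LieModule.Weight K H L, (γ : H → K) = α + β → 0 < ht α → 0 < ht β →
      P α → P β → P γ)
    {α : LieModule.Weight K H L} (hα : 0 < ht α) : P α := by
  have key {i : H.root} (hi : B.IsPos i) : 0 < ht i ∧ P i := by
    refine hi.induction_on_add (p := fun i => 0 < ht i ∧ P i)
      (fun i hi => ⟨hB i hi, simple i hi⟩) fun i j k hk hi hj => ?_
    have hk' : ((k : LieModule.Weight K H L) : H → K) = i + j := by
      ext x
      exact congr($hk x)
    have h₁ := hz.eq_add hk'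
    have h₂ := hB j hj
    have h₃ := hi.1
    exact ⟨by lia, add i j k hk' hi.1 h₂ hi.2 (simple j hj)⟩
  let := (rootSystem H).indexNeg
  let i : H.root := ⟨α, isNonZero_iff_mem_root.mp (hz.isNonZero hα.ne')⟩
  rcases RootPairing.Base.IsPos.or_neg B i with hi | hi
  · exact (key hi).2
  · exfalso
    have h₁ := (key hi).1
    have h₂ : ((-i : H.root) : LieModule.Weight K H L) = -α := by
      have h₃ : (rootSystem H).root (-i) = -(rootSystem H).root i := by
        rw [RootPairing.indexNeg_neg, RootPairing.root_reflectionPerm,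
          RootPairing.reflection_apply_self]
      ext x
      rw [LieModule.Weight.coe_neg]
      exact congr($h₃ x)
    rw [h₂, hz.apply_neg] at h₁
    lia

/-- A pair of subalgebras containing the opposite Borel subalgebras attached to a height
function. -/
structure IsOppositePair (ht : LieModule.Weight K H L → ℤ) (p p' : LieSubalgebra K L) : Prop where
  le_left : H ≤ p
  le_right : H ≤ p'
  pos : ∀ α : LieModule.Weight K H L, 0 < ht α → (rootSpace H α).toSubmodule ≤ p.toSubmodule
  neg : ∀ α : LieModule.Weight K H L, ht α < 0 → (rootSpace H α).toSubmodule ≤ p'.toSubmodule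

namespace IsOppositePair

variable {p p' : LieSubalgebra K L}

lemma symm (h : IsOppositePair ht p p') : IsOppositePair (fun χ => -ht χ) p' p where
  le_left := h.le_right
  le_right := h.le_left
  pos α hα := h.neg α (neg_pos.mp hα)
  neg α hα := h.pos α (neg_neg_iff_pos.mp hα)

lemma le_inf (h : IsOppositePair ht p p') : H ≤ p ⊓ p' := _root_.le_inf h.le_left h.le_right

lemma mem_rootsIn_inf (h : IsOppositePair ht p p') {α : LieModule.Weight K H L} :
    α ∈ rootsIn ht (p ⊓ p') ↔ 0 < ht α ∧ (rootSpace H α).toSubmodule ≤ p'.toSubmodule := by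
  rw [mem_rootsIn]
  refine and_congr_right fun hα => ⟨fun h' v hv => (h' hv).2, fun h' v hv => ?_⟩
  exact ⟨h.pos α hα hv, h' hv⟩

/-- Positive root spaces are already in `p`, so only membership in `p'` matters. Closure under
positive differences holds because `p'` contains every negative root space, in particular that of
`-β`. -/
lemma isClosedPositive (hz : IsHeight z ht) (h : IsOppositePair ht p p') :
    IsClosedPositive ht (rootsIn ht (p ⊓ p')) where
  pos α hα := (mem_rootsIn.mp hα).1
  add α hα β hβ γ hγ := by
    rw [h.mem_rootsIn_inf] at *
    have hγ' : 0 < ht γ := by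
      rw [hz.eq_add hγ]
      exact add_pos hα.1 hβ.1
    exact ⟨hγ', rootSpace_le_of_eq_add (hz.isNonZero hα.1.ne') (hz.isNonZero hβ.1.ne')
      (hz.isNonZero hγ'.ne') hγ hα.2 hβ.2⟩
  sub α hα β hβ γ hγ hγ' := by
    rw [h.mem_rootsIn_inf] at *
    have hβ' : ht (-β) < 0 := by
      rw [hz.apply_neg]
      exact neg_neg_iff_pos.mpr hβ.1
    refine ⟨hγ', rootSpace_le_of_eq_add (hz.isNonZero hα.1.ne') (hz.isNonZero hβ'.ne)
      (hz.isNonZero hγ'.ne') ?_ hα.2 (h.neg _ hβ')⟩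
    rw [hγ, LieModule.Weight.coe_neg, sub_eq_add_neg]

/-- If the negative of a sum of positive roots occurs in a parabolic subalgebra, then so do the
negatives of the summands. -/
lemma rootSpace_neg_le_of_eq_add (hz : IsHeight z ht) (h : IsOppositePair ht p p')
    {α β γ : LieModule.Weight K H L} (hα : 0 < ht α) (hβ : 0 < ht β)
    (hγ : (γ : H → K) = α + β)
    (hγp : (rootSpace H (-γ : LieModule.Weight K H L)).toSubmodule ≤ p.toSubmodule) :
    (rootSpace H (-α : LieModule.Weight K H L)).toSubmodule ≤ p.toSubmodule := by
  have hγ' : 0 < ht γ := by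
    rw [hz.eq_add hγ]
    exact add_pos hα hβ
  have hn {χ : LieModule.Weight K H L} (hχ : 0 < ht χ) : (-χ).IsNonZero :=
    hz.isNonZero (by rw [hz.apply_neg]; exact neg_ne_zero.mpr hχ.ne')
  refine rootSpace_le_of_eq_add (hn hγ') (hz.isNonZero hβ.ne') (hn hα) ?_ hγp (h.pos β hβ)
  rw [LieModule.Weight.coe_neg, LieModule.Weight.coe_neg, hγ]
  abel

/-- An element of the Cartan subalgebra which cuts out the roots of the Levi factor of a parabolic
subalgebra. -/
lemma exists_cartan_apply_eq_zero_iff (hz : IsHeight z ht) (h : IsOppositePair ht p p')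
    {B : (rootSystem H).Base} (hB : ∀ i ∈ B.support, 0 < ht i) :
    ∃ (x : H) (c : H.root → ℕ), (∀ i ∈ B.support, (i : LieModule.Weight K H L) x = c i) ∧
      ∀ α : LieModule.Weight K H L, 0 < ht α → (α x = 0 ↔
        (rootSpace H (-α : LieModule.Weight K H L)).toSubmodule ≤ p.toSubmodule) := by
  classical
  -- Value `0` on the simple roots of the Levi factor of `p`, `1` on the others. A sum of positive
  -- roots has its negative in `p` exactly when both summands do, which propagates the criterion to
  -- all positive roots.
  let c (i : H.root) : ℕ := if (rootSpace H (-(i : LieModule.Weight K H L) :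
    LieModule.Weight K H L)).toSubmodule ≤ p.toSubmodule then 0 else 1
  obtain ⟨x, hx⟩ := exists_forall_support_apply_eq B fun i => (c i : K)
  refine ⟨x, c, hx, fun α hα => ?_⟩
  suffices (∃ n : ℕ, α x = n) ∧ (α x = 0 ↔
      (rootSpace H (-α : LieModule.Weight K H L)).toSubmodule ≤ p.toSubmodule) from this.2
  refine hz.induction hB (P := fun α => (∃ n : ℕ, α x = n) ∧ (α x = 0 ↔
    (rootSpace H (-α : LieModule.Weight K H L)).toSubmodule ≤ p.toSubmodule)) ?_ ?_ hα
  · intro i hi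
    refine ⟨⟨c i, hx i hi⟩, ?_⟩
    rw [hx i hi, Nat.cast_eq_zero]
    simp [c]
  · intro α β γ hγ hα hβ ihα ihβ
    obtain ⟨⟨m, hm⟩, ihα⟩ := ihα
    obtain ⟨⟨n, hn⟩, ihβ⟩ := ihβ
    have hγx : γ x = (m + n : ℕ) := by
      rw [hγ, Pi.add_apply, hm, hn, Nat.cast_add]
    refine ⟨⟨m + n, hγx⟩, ?_⟩
    rw [hm, Nat.cast_eq_zero] at ihα
    rw [hn, Nat.cast_eq_zero] at ihβ
    rw [hγx, Nat.cast_eq_zero, Nat.add_eq_zero_iff, ihα, ihβ]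
    have hγ' : 0 < ht γ := by
      rw [hz.eq_add hγ]
      exact add_pos hα hβ
    have hneg {χ : LieModule.Weight K H L} (hχ : 0 < ht χ) : (-χ).IsNonZero :=
      hz.isNonZero (by rw [hz.apply_neg]; exact neg_ne_zero.mpr hχ.ne')
    refine ⟨fun ⟨h₁, h₂⟩ => ?_, fun h' => ⟨h.rootSpace_neg_le_of_eq_add hz hα hβ hγ h',
      h.rootSpace_neg_le_of_eq_add hz hβ hα (by rw [hγ, add_comm]) h'⟩⟩
    refine rootSpace_le_of_eq_add (hneg hα) (hneg hβ) (hneg hγ') ?_ h₁ h₂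
    simp only [LieModule.Weight.coe_neg, hγ]
    abel

/-- If the isotropic forms of the two halves agree, then the roots of the first half are opposite to
roots of the second. -/
lemma rootSpace_neg_le_of_isotropyDual_eq (hz : IsHeight z ht) (h : IsOppositePair ht p p')
    {F F' : Dual K L} (hF : IsNondegenerateOn F (rootsIn ht (p ⊓ p')))
    (hE : isotropyDual F (rootsIn ht (p ⊓ p')) =
      isotropyDual F' (rootsIn (fun χ => -ht χ) (p ⊓ p')))
    {α : LieModule.Weight K H L} (hα : α ∈ rootsIn ht (p ⊓ p')) :
    (rootSpace H (-α : LieModule.Weight K H L)).toSubmodule ≤ p.toSubmodule := by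
  classical
  by_contra hαp
  set N := rootsIn ht (p ⊓ p') with hN
  obtain ⟨ε, hε, hmax⟩ := (N.filter fun α : LieModule.Weight K H L =>
    ¬ (rootSpace H (-α : LieModule.Weight K H L)).toSubmodule ≤ p.toSubmodule).exists_max_image ht
      ⟨α, Finset.mem_filter.mpr ⟨hα, hαp⟩⟩
  rw [Finset.mem_filter] at hε
  have hcl := h.isClosedPositive hz
  have hε₀ := hcl.pos ε hε.1
  obtain ⟨e, he, he₀⟩ := ε.exists_ne_zero
  -- A root `ε + β` with `β ∈ N` would again be a counterexample, of greater height.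
  have hcentral : weightSum N ≤ LinearMap.ker (ad K L e) := by
    refine iSup₂_le fun β hβ v hv => ?_
    rw [LinearMap.mem_ker, ad_apply]
    by_contra hne
    obtain ⟨γ, hγ⟩ := exists_weight_of_ne_zero (lie_mem_rootSpace_add he hv) hne
    have hβ₀ := hcl.pos β hβ
    have h₁ := hmax γ (Finset.mem_filter.mpr ⟨hcl.add ε hε.1 β hβ γ hγ, fun hγp =>
      hε.2 (h.rootSpace_neg_le_of_eq_add hz hε₀ hβ₀ hγ hγp)⟩)
    have h₂ := hz.eq_add hγ
    lia
  have hiso : e ∈ isotropy F N := ⟨rootSpace_le_weightSum hε.1 he, fun v hv => by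
    have := hcentral hv
    rw [LinearMap.mem_ker, ad_apply] at this
    rw [← lie_skew, this, neg_zero, map_zero]⟩
  have hdual (k : H) : cartanDual H F e k = ε k * F e := by
    rw [cartanDual_apply]
    have : ⁅(k : L), e⁆ = ε k • e := lie_eq_smul_of_mem_rootSpace he k
    rw [this, map_smul, smul_eq_mul]
  have hFe : F e ≠ 0 := fun hFe => he₀ (hF.eq_zero e hiso (LinearMap.ext fun k => by
    rw [hdual, hFe, mul_zero, LinearMap.zero_apply]))
  obtain ⟨k, hk, hk'⟩ : cartanDual H F e ∈ isotropyDual F' _ := hE.le ⟨e, hiso, rfl⟩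
  obtain ⟨B, hB⟩ := hz.exists_base
  obtain ⟨x, -, -, hx⟩ := h.exists_cartan_apply_eq_zero_iff hz hB
  refine hε.2 ((hx ε hε₀).mp ?_)
  -- The negative roots of `p ⊓ p'` occur in `p`, so they vanish at `x`, and so does every form in
  -- the second isotropic space. One such form is the nonzero multiple `F e` of `ε`.
  have hxk : weightSum (rootsIn (fun χ => -ht χ) (p ⊓ p')) ≤ LinearMap.ker (ad K L (x : L)) := by
    refine iSup₂_le fun β hβ v hv => ?_
    have : ⁅(x : L), v⁆ = β x • v := lie_eq_smul_of_mem_rootSpace hv x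
    rw [LinearMap.mem_ker, ad_apply, this]
    rw [mem_rootsIn] at hβ
    have h₁ := (hx (-β) (by rw [hz.apply_neg]; exact hβ.1)).mpr (by
      rw [neg_neg]
      exact fun v hv => (hβ.2 hv).1)
    rw [LieModule.Weight.coe_neg, Pi.neg_apply, neg_eq_zero] at h₁
    rw [h₁, zero_smul]
  have h₁ : ε x * F e = 0 := by
    have := hxk hk.1
    rw [LinearMap.mem_ker, ad_apply] at this
    rw [← hdual, ← hk', cartanDual_apply, this, map_zero]
  exact (mul_eq_zero.mp h₁).resolve_right hFe

/-- The intersection is a Levi subalgebra if its set of roots is symmetric. -/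
lemma isLevi_inf (hz : IsHeight z ht) (h : IsOppositePair ht p p')
    (hsymm : ∀ α : LieModule.Weight K H L, 0 < ht α →
      ((rootSpace H α).toSubmodule ≤ p'.toSubmodule ↔
        (rootSpace H (-α : LieModule.Weight K H L)).toSubmodule ≤ p.toSubmodule)) :
    IsLevi (p ⊓ p') := by
  obtain ⟨B, hB⟩ := hz.exists_base
  obtain ⟨x, c, hxc, hx⟩ := h.exists_cartan_apply_eq_zero_iff hz hB
  have hcases (α : LieModule.Weight K H L) (hα : α.IsNonZero) :
      (rootSpace H α).toSubmodule ≤ (p ⊓ p').toSubmodule ↔ α x = 0 := by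
    rcases (hz.ne_zero α hα).lt_or_gt with hlt | hlt
    · have hα' : 0 < ht (-α) := by rw [hz.apply_neg]; exact neg_pos.mpr hlt
      have h₁ := hx (-α) hα'
      rw [LieModule.Weight.coe_neg, Pi.neg_apply, neg_eq_zero, neg_neg] at h₁
      rw [h₁]
      exact ⟨fun h' v hv => (h' hv).1, fun h' v hv => ⟨h' hv, h.neg α hlt hv⟩⟩
    · rw [hx α hlt, ← hsymm α hlt]
      exact ⟨fun h' v hv => (h' hv).2, fun h' v hv => ⟨h.pos α hlt hv, h' hv⟩⟩
  let S : Set H.root := {i ∈ (B.support : Set H.root) | c i = 0}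
  have hS (i : H.root) : i ∈ rootsSpannedBy S ↔ (i : LieModule.Weight K H L) x = 0 := by
    constructor
    · intro hi
      change (rootSystem H).root i ∈ AddSubgroup.closure ((rootSystem H).root '' S) at hi
      suffices (rootSystem H).root i x = 0 from this
      generalize (rootSystem H).root i = f at hi
      induction hi using AddSubgroup.closure_induction with
      | zero => rfl
      | mem f hf =>
        obtain ⟨j, hj, rfl⟩ := hf
        refine (hxc j hj.1).trans ?_
        rw [hj.2, Nat.cast_zero]
      | add f g _ _ hf hg => rw [LinearMap.add_apply, hf, hg, add_zero]
      | neg f _ hf => rw [LinearMap.neg_apply, hf, neg_zero]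
    · intro hi
      have key {f : Dual K H}
          (hf : f ∈ AddSubmonoid.closure ((rootSystem H).root '' (B.support : Set H.root)))
          (hfx : f x = 0) : f ∈ AddSubgroup.closure ((rootSystem H).root '' S) := by
        obtain ⟨n, hn, hn'⟩ := exists_nat_apply_eq_of_mem_closure hxc hf
        rw [hfx, eq_comm, Nat.cast_eq_zero] at hn
        exact AddSubgroup.le_closure_toAddSubmonoid _ (hn' hn)
      change (rootSystem H).root i ∈ AddSubgroup.closure ((rootSystem H).root '' S)
      have hi' : (rootSystem H).root i x = 0 := hi
      rcases B.root_mem_or_neg_mem i with hf | hf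
      · exact key hf hi'
      · rw [← neg_mem_iff]
        exact key hf (by rw [LinearMap.neg_apply, hi', neg_zero])
  refine ⟨H, inferInstance, B, S, fun i hi => hi.1, le_antisymm ?_ ?_⟩
  · refine le_of_forall_weight H (fun k hk v hv => (p ⊓ p').lie_mem (h.le_inf hk) hv)
      fun χ v hv hχ => ?_
    by_cases hv₀ : v = 0
    · rw [hv₀]; exact zero_mem _
    by_cases hχ₀ : χ.IsZero
    · exact Submodule.mem_sup_left (mem_cartan_of_mem_rootSpace_zero hχ₀ hχ)
    have h₁ := (hcases χ hχ₀).mp (rootSpace_le_of_mem hχ₀ hχ hv₀ hv)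
    exact Submodule.mem_sup_right (Submodule.mem_iSup_of_mem
      ⟨χ, isNonZero_iff_mem_root.mp hχ₀⟩ (Submodule.mem_iSup_of_mem ((hS _).mpr h₁) hχ))
  · refine sup_le h.le_inf (iSup₂_le fun i hi => ?_)
    exact (hcases i (isNonZero_iff_mem_root.mpr i.2)).mpr ((hS i).mp hi)

theorem index_le_and_isLevi (hz : IsHeight z ht) (h : IsOppositePair ht p p') :
    index K ↥(p ⊓ p') ≤ finrank K H ∧
      (index K ↥(p ⊓ p') = finrank K H → IsLevi (p ⊓ p')) := by
  obtain ⟨F, hF⟩ := (h.isClosedPositive hz).exists_isNondegenerateOn hz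
  have hcl := h.symm.isClosedPositive hz.neg
  rw [inf_comm] at hcl
  obtain ⟨F', hF'⟩ := hcl.exists_isNondegenerateOn hz.neg
  refine ⟨hF.index_le_finrank hz h.le_inf hF', fun hindex => h.isLevi_inf hz fun α hα => ?_⟩
  have hE := hF.isotropyDual_eq_of_index_eq hz h.le_inf hF' hindex
  refine ⟨fun h' => h.rootSpace_neg_le_of_isotropyDual_eq hz hF hE
    (h.mem_rootsIn_inf.mpr ⟨hα, h'⟩), fun h' => ?_⟩
  -- The reverse implication is the same statement for the pair with its members exchanged and the
  -- heights negated.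
  have h₁ := h.symm.rootSpace_neg_le_of_isotropyDual_eq (F := F') (F' := F) hz.neg
    (by rwa [inf_comm]) (by simpa [inf_comm p' p] using hE.symm) (α := -α)
    (h.symm.mem_rootsIn_inf.mpr ⟨by rw [hz.apply_neg, neg_neg]; exact hα, h'⟩)
  rwa [neg_neg] at h₁

end IsOppositePair

end Opposite

/-! ### The bound and the equality case for special subalgebras -/

section Main

variable {K L : Type*} [Field K] [CharZero K] [IsAlgClosed K] [LieRing L] [LieAlgebra K L]
  [FiniteDimensional K L] [IsSemisimple K L]

theorem IsSpecial.index_le_rank_and_isLevi {q : LieSubalgebra K L} (hq : IsSpecial q) :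
    index K q ≤ LieAlgebra.rank K L ∧ (index K q = LieAlgebra.rank K L → IsLevi q) := by
  obtain ⟨p, p', hp, hp', hpp', rfl⟩ := hq
  obtain ⟨H, hH, z, hHp, hHp', hz⟩ := exists_common_cartan hp hp' hpp'
  have hex (α : LieModule.Weight K H L) : ∃ i : ℤ, α z = i ∧ (α.IsNonZero → i ≠ 0) ∧
      (0 < i → (rootSpace H α).toSubmodule ≤ p.toSubmodule) ∧
      (i < 0 → (rootSpace H α).toSubmodule ≤ p'.toSubmodule) := by
    by_cases hα : α.IsZero
    · refine ⟨0, ?_, fun h => absurd hα h, fun h => absurd h (lt_irrefl _),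
        fun h => absurd h (lt_irrefl _)⟩
      rw [hα.eq]
      simp
    · obtain ⟨i, hi, hi', h₁, h₂⟩ := hz α hα
      exact ⟨i, hi', fun _ => hi, h₁, h₂⟩
  choose ht h₁ h₂ h₃ h₄ using hex
  rw [← finrank_cartan_eq_rank H]
  exact IsOppositePair.index_le_and_isLevi (z := z) (ht := ht) ⟨h₁, h₂⟩ ⟨hHp, hHp', h₃, h₄⟩

end Main

end SpecialSubalgebra

theorem mainTheorem1 {K L : Type*} [Field K] [IsAlgClosed K] [CharZero K]
    [LieRing L] [LieAlgebra K L] [FiniteDimensional K L] [LieAlgebra.IsSemisimple K L]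
    (q : LieSubalgebra K L) (hq : SpecialSubalgebra.IsSpecial q) :
    SpecialSubalgebra.index K q ≤ LieAlgebra.rank K L ∧
      (SpecialSubalgebra.index K q = LieAlgebra.rank K L ↔ SpecialSubalgebra.IsLevi q) :=
  ⟨hq.index_le_rank_and_isLevi.1, hq.index_le_rank_and_isLevi.2,
    fun h => le_antisymm hq.index_le_rank_and_isLevi.1 h.rank_le_index⟩
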